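/- \textbf{Definitions.} A \emph{continuum} is a nonempty compact connected metrizable space; it is \emph{non-degenerate} if it has more than one point. A \emph{dendrite} is a locally connected continuum containing no subset homeomorphic to the unit circle. Let $X$ be a dendrite. For nonempty $P\subset X$ let $T(P)$ be the smallest subcontinuum of $X$ containing $P$, and let $[x,y]=T(\{x,y\})$. A point $y$ of a connected set $Y$ is an \emph{endpoint} of $Y$ if $Y\setminus\{y\}$ is connected (the empty set counts as connected). A \emph{critical point} of $f:X\to X$ is a point with no neighborhood on which $f$ is one-to-one. A \emph{$2$-to-$1$ branched covering} $f:X\to X$ is a continuous open map with finitely many critical points such that $f^{-1}(f(c))=\{c\}$ for each critical point $c$, and every fibre without critical points has exactly two points. Let $\mathcal{T}$ be the family of $2$-to-$1$ branched coverings $f:X\to X$ of dendrites such that \begin{itemize} \item $f$ has no wandering continua: there is no non-degenerate continuum $K\subset X$ with $f^n(K)\cap f^m(K)=\emptyset$ for all $m\ne n$ in $\{0,1,2,\dots\}$; and \item $f$ has no identity return: there are no non-degenerate continuum $K\subset X$ and integer $n>0$ with $f^n|_K=\mathrm{id}_K$. \end{itemize} Let $\mathcal{TP}$ be the family of those $f\in\mathcal{T}$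 whose (unique) critical point $c_f$ is periodic. Consider triples $(f,P,X)$ where $X$ is a dendrite, $f$ is a map into $X$ defined at least on $P$ (only $f|_P$ matters), and $P\subset X$ is a (finite) periodic orbit of $f$. Two triples $(f,P,X)$, $(f',P',X')$ are equivalent if there is a homeomorphism $h:T(P)\to T(P')$ with $h(P)=P'$ and $h\circ f=f'\circ h$ on $P$; the equivalence classes are called \emph{patterns}. The pattern of a periodic point $x$ of $f$ is the pattern of $(f,\mathrm{orb}_f(x),X)$. \begin{itemize} \item $(f,P,X)$ is \emph{basic rotational} if all points of $P$ are endpoints of $T(P)$ and there is $a\in T(P)$ such that $[p,a]\cap[q,a]=\{a\}$ for all $p\ne q$ in $P$. \item $(f,P,X)$ is \emph{non-trivial rotational with the $n$ blocks} $Q,f(Q),\dots,f^{n-1}(Q)$ if these sets form a partition of $P$, $f^n(Q)=Q$, each has more than one point, their hulls $T(f^i(Q))$ are pairwise disjoint, the set $B=T(P)\setminus\bigcup_{i<n}T(f^i(Q))$ is connected, and there is $a\in B$ such that different blocks lie in different components of $T(P)\setminus\{a\}$. \item $(f,P,X)$ is \emph{non-trivial rotational of generation $1$} with the $n$ blocks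 $Q,\dots,f^{n-1}(Q)$ if the previous item holds. It is \emph{non-trivial rotational of generation $k+1$} with the $nm$ blocks $f^j(R)$, $0\le j<nm$, if it is non-trivial rotational of generation $k$ with some $n$ blocks $f^i(Q)$, $0\le i<n$, and for each $0\le i<n$ the triple $(f^n,f^i(Q),X)$ is non-trivial rotational with the $m$ blocks $f^{i}(R), f^{i+n}(R),\dots,f^{i+(m-1)n}(R)$. \item $(f,P,X)$ is a \emph{snowflake of generation $1$} if it is basic rotational. It is a \emph{snowflake of generation $k+1$}, $k\ge 1$, if it is non-trivial rotational of generation $k$ with some $n$ blocks $f^i(Q)$, $0\le i<n$, such that all triples $(f^n,f^i(Q),X)$, $0\le i<n$, are basic rotational. \end{itemize} A pattern is a \emph{snowflake} if it is the class of a triple which is a snowflake of some generation. \textbf{Lemma.} Let $f\in\mathcal{TP}$. Then the pattern of the periodic orbit of the critical point $c_f$ is not a snowflake. -/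

import Mathlib

universe u

/-- A dendrite: a (metrizable) locally connected continuum which contains no subset homeomorphic to
the unit circle. -/
class Dendrite (X : Type u) [TopologicalSpace X] : Prop extends
    CompactSpace X, ConnectedSpace X, LocallyConnectedSpace X,
    TopologicalSpace.MetrizableSpace X where
  not_isEmbedding_circle : ∀ g : Circle → X, ¬ Topology.IsEmbedding g

section Topological

variable {X : Type u} [TopologicalSpace X]

/-- A continuum in `X`: a nonempty compact connected subset. -/
def IsContinuum (K : Set X) : Prop :=
  IsCompact K ∧ IsConnected K

/-- The continuum hull `T(P)`: the intersection of all subcontinua containing `P`. In a dendrite,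
for nonempty `P`, this is the smallest continuum containing `P`. -/
def continuumHull (P : Set X) : Set X :=
  ⋂₀ {K | IsContinuum K ∧ P ⊆ K}

theorem subset_continuumHull (P : Set X) : P ⊆ continuumHull P :=
  fun _ hx _ hK => hK.2 hx

/-- The arc `[x, y]` of a dendrite (which is `{x}` if `x = y`). -/
def dendriteArc (x y : X) : Set X :=
  continuumHull {x, y}

/-- `y` is an endpoint of the connected set `Y`: a point of `Y` which is not a cutpoint of `Y`. -/
def IsEndpointOf (Y : Set X) (y : X) : Prop :=
  y ∈ Y ∧ IsPreconnected (Y \ {y})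

/-- A critical point of a map: a point with no neighborhood on which the map is one-to-one. -/
def IsCriticalPoint (f : X → X) (x : X) : Prop :=
  ∀ U ∈ nhds x, ¬ Set.InjOn f U

/-- A `2`-to-`1` branched covering of `X` by itself: a continuous open map with finitely many
critical points such that a critical point is the only point in its fibre, and every fibre without
critical points has exactly two points. -/
structure IsTwoToOneBranchedCovering (f : X → X) : Prop where
  continuous : Continuous f
  isOpenMap : IsOpenMap f
  finite_critical : {x | IsCriticalPoint f x}.Finite
  fibre_critical : ∀ c, IsCriticalPoint f c → f ⁻¹' {f c} = {c}
  fibre_regular : ∀ y, (∀ c, IsCriticalPoint f c → f c ≠ y) → (f ⁻¹' {y}).ncard = 2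

/-- `f` has a wandering continuum: a non-degenerate continuum whose images under distinct iterates
of `f` are disjoint. -/
def HasWanderingContinuum (f : X → X) : Prop :=
  ∃ K : Set X, IsContinuum K ∧ K.Nontrivial ∧
    ∀ m n : ℕ, m ≠ n → Disjoint (f^[m] '' K) (f^[n] '' K)

/-- `f` has an identity return: some positive iterate is the identity on a non-degenerate
continuum. -/
def HasIdentityReturn (f : X → X) : Prop :=
  ∃ K : Set X, IsContinuum K ∧ K.Nontrivial ∧ ∃ n : ℕ, 0 < n ∧ ∀ x ∈ K, f^[n] x = x

/-- The class `𝒯(X)`. -/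
structure IsClassT (f : X → X) : Prop where
  branched : IsTwoToOneBranchedCovering f
  no_wandering : ¬ HasWanderingContinuum f
  no_identity_return : ¬ HasIdentityReturn f

/-- The forward orbit of `p` under `f`. -/
def forwardOrbit (f : X → X) (p : X) : Set X :=
  Set.range fun n : ℕ => f^[n] p

/-- `(f, P, X)` is basic rotational: all points of `P` are endpoints of `T(P)`, and for some
`a ∈ T(P)` the arcs from the points of `P` to `a` meet only at `a`. -/
def IsBasicRotational (f : X → X) (P : Set X) : Prop :=
  Set.MapsTo f P P ∧
  (∀ p ∈ P, IsEndpointOf (continuumHull P) p) ∧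
  ∃ a ∈ continuumHull P, ∀ p ∈ P, ∀ q ∈ P, p ≠ q → dendriteArc p a ∩ dendriteArc q a = {a}

/-- `Q, f(Q), …, f^{n-1}(Q)` is a block structure of `(f, P, X)`: a partition of `P` into
non-degenerate sets, cyclically permuted by `f`, with pairwise disjoint continuum hulls. -/
structure IsBlockStructure (f : X → X) (P : Set X) (n : ℕ) (Q : Set X) : Prop where
  union_eq : ⋃ i < n, f^[i] '' Q = P
  return_eq : f^[n] '' Q = Q
  nontrivial : ∀ i < n, (f^[i] '' Q).Nontrivial
  disjoint_hulls : ∀ i < n, ∀ j < n, i ≠ j →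
    Disjoint (continuumHull (f^[i] '' Q)) (continuumHull (f^[j] '' Q))

/-- The part `B` of `T(P)` outside of the (continuum hulls of the) blocks `Q, …, f^{n-1}(Q)`. -/
def hullComplement (f : X → X) (P : Set X) (n : ℕ) (Q : Set X) : Set X :=
  continuumHull P \ ⋃ i < n, continuumHull (f^[i] '' Q)

/-- `(f, P, X)` exhibits a non-trivial rotational pattern (of generation `1`) with the `n` blocks
`Q, f(Q), …, f^{n-1}(Q)`: these form a block structure, `B` is connected, and there is a point `a`
of `B` such that components of `T(P) \ {a}` containing different blocks are disjoint.
As `a ∈ B`, there are at least two blocks, and each of them lies in one component. -/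
structure IsNontrivialRotational (f : X → X) (P : Set X) (n : ℕ) (Q : Set X) : Prop where
  blocks : IsBlockStructure f P n Q
  isConnected : IsConnected (hullComplement f P n Q)
  center : ∃ a ∈ hullComplement f P n Q, ∀ i < n, ∀ j < n, i ≠ j →
    ∀ p ∈ f^[i] '' Q, ∀ q ∈ f^[j] '' Q,
      Disjoint (connectedComponentIn (continuumHull P \ {a}) p)
        (connectedComponentIn (continuumHull P \ {a}) q)

/-- `IsRotationalOfGeneration f P k n Q`: the pattern of `(f, P, X)` is non-trivial rotational of
generation `k`, and the blocks of generation `k`, into which `P` is partitioned, are the `n` sets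
`Q, f(Q), …, f^{n-1}(Q)`. In passing to the next generation, every block `f^i(Q)` is non-trivial
rotational for `f^n`, with `m` blocks, namely the `f^i`-images of the blocks of `Q`. -/
inductive IsRotationalOfGeneration (f : X → X) (P : Set X) : ℕ → ℕ → Set X → Prop
  | first {n : ℕ} {Q : Set X} (h : IsNontrivialRotational f P n Q) :
      IsRotationalOfGeneration f P 1 n Q
  | next {k n m : ℕ} {Q R : Set X} (h : IsRotationalOfGeneration f P k n Q)
      (hR : ∀ i < n, IsNontrivialRotational f^[n] (f^[i] '' Q) m (f^[i] '' R)) :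
      IsRotationalOfGeneration f P (k + 1) (n * m) R

/-- `(f, P, X)` is a snowflake of generation `k ≥ 1`. -/
inductive IsSnowflake (f : X → X) (P : Set X) : ℕ → Prop
  | basic (h : IsBasicRotational f P) : IsSnowflake f P 1
  | succ {k n : ℕ} {Q : Set X} (h : IsRotationalOfGeneration f P k n Q)
      (hQ : ∀ i < n, IsBasicRotational f^[n] (f^[i] '' Q)) : IsSnowflake f P (k + 1)

end Topological

/-- A triple `(f, P, X)`, where `X` is a dendrite and `P` is the orbit of a periodic point `p`
of `f`. Only the values of `f` on `P` matter. -/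
structure OrbitTriple : Type (u + 1) where
  X : Type u
  [top : TopologicalSpace X]
  [dendrite : Dendrite X]
  f : X → X
  p : X
  periodic : p ∈ Function.periodicPts f

attribute [instance] OrbitTriple.top OrbitTriple.dendrite

namespace OrbitTriple

/-- The orbit `P` of the triple. -/
def P (s : OrbitTriple.{u}) : Set s.X :=
  forwardOrbit s.f s.p

theorem f_mem (s : OrbitTriple.{u}) {x : s.X} (hx : x ∈ s.P) : s.f x ∈ s.P := by
  obtain ⟨n, rfl⟩ := hx
  exact ⟨n + 1, Function.iterate_succ_apply' s.f n s.p⟩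

/-- Two triples are equivalent if there is a homeomorphism of the continuum hulls `T(P)` which
takes one orbit to the other one and conjugates the maps on them. -/
def Equivalent (s t : OrbitTriple.{u}) : Prop :=
  ∃ h : continuumHull s.P ≃ₜ continuumHull t.P,
    (∀ x : continuumHull s.P, (x : s.X) ∈ s.P ↔ (h x : t.X) ∈ t.P) ∧
    ∀ x y : continuumHull s.P, (x : s.X) ∈ s.P → (y : s.X) = s.f x → (h y : t.X) = t.f (h x)

theorem equivalence : Equivalence (Equivalent.{u}) where
  refl s := ⟨Homeomorph.refl _, fun _ => Iff.rfl, fun _ _ _ h => h⟩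
  symm := by
    rintro s t ⟨h, hP, hf⟩
    refine ⟨h.symm, fun x => ?_, fun x y hx hy => ?_⟩
    · rw [hP (h.symm x), h.apply_symm_apply]
    · have hx' : (h.symm x : s.X) ∈ s.P := by
        rw [hP (h.symm x), h.apply_symm_apply]; exact hx
      have key := hf (h.symm x) ⟨_, subset_continuumHull _ (s.f_mem hx')⟩ hx' rfl
      rw [h.apply_symm_apply, ← hy] at key
      rw [← Subtype.ext key, h.symm_apply_apply]
  trans := by
    rintro s t r ⟨h, hP, hf⟩ ⟨g, gP, gf⟩
    exact ⟨h.trans g, fun x => (hP x).trans (gP (h x)),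
      fun x y hx hy => gf _ _ ((hP x).1 hx) (hf x y hx hy)⟩

instance setoid : Setoid OrbitTriple.{u} := ⟨Equivalent, equivalence⟩

end OrbitTriple

/-- A pattern: an equivalence class of triples `(f, P, X)`. -/
def Pattern : Type (u + 1) :=
  Quotient OrbitTriple.setoid.{u}

/-- A pattern is a snowflake of generation `k` if it is the pattern of a triple that is one. -/
def Pattern.IsSnowflakeOfGeneration (π : Pattern.{u}) (k : ℕ) : Prop :=
  ∃ s : OrbitTriple.{u}, Quotient.mk OrbitTriple.setoid s = π ∧ IsSnowflake s.f s.P k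

/-- A pattern is a snowflake if it is a snowflake of some generation. -/
def Pattern.IsSnowflake (π : Pattern.{u}) : Prop :=
  ∃ k : ℕ, π.IsSnowflakeOfGeneration k

/-- The pattern of a periodic point `x` of a map `f` of a dendrite. -/
def patternOf {X : Type u} [TopologicalSpace X] [Dendrite X] (f : X → X) (x : X)
    (hx : x ∈ Function.periodicPts f) : Pattern.{u} :=
  Quotient.mk OrbitTriple.setoid ⟨X, f, x, hx⟩

/-! Only the finest blocks of a snowflake matter. They partition the orbit, are permuted cyclically,
have disjoint hulls, and consist of endpoints of their hulls. This is `IsEndpointBlockStructure`; it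
passes along the homeomorphism of an equivalence of triples, so the orbit of the critical point `c`
would carry one itself.

The involution swapping the two points of a fibre shows that the arc joining them contains the
critical point. Hence `f` is injective on connected sets missing `c`, and still so when `c` is added
(`IsTwoToOneBranchedCovering.injOn_insert`). A block hull either misses `c`, or has `c` as an
endpoint and stays connected without it. So `f` is injective on every hull, carries hulls to hulls,
and, the hulls being disjoint, is injective on their union.

Let `N` be the period of `c` and `q` another point of its block. Then `f^[N]` fixes `c` and `q`,
hence maps the arc between them onto itself, acting near `c` as an increasing function of the
parameter. If this is the identity near `c`, there is an identity return. Otherwise a point is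
moved, and a short piece of arc beside it never meets its later images; by injectivity on the
invariant union it wanders. This dichotomy is `hasIdentityReturn_or_hasWanderingContinuum`.

If the orbit is just `c`, there is no such `q`. Then `c` is totally invariant and the components of
its complement are mapped into one another. Either some orbit of components never repeats, and an
arc inside its first component wanders, or some component is periodic, and the same dichotomy
applies to an arc issuing from `c`.

All this rests on unique arcs in dendrites: open connected sets are path connected, paths contain
arcs, and two different arcs with common ends would create a circle. -/

open Set Filter Topology

/-! ### Path connectedness of connected open sets in complete locally connected metric spaces. -/

section PathsInLocallyConnectedSpaces

variable {X : Type u} [MetricSpace X]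

/-- Two points are `ε`-linked if they lie in a connected open set of diameter at most `ε`. -/
def IsLinked (ε : ℝ) (x y : X) : Prop :=
  ∃ V : Set X, IsOpen V ∧ IsPreconnected V ∧ x ∈ V ∧ y ∈ V ∧ ∀ a ∈ V, ∀ b ∈ V, dist a b ≤ ε

theorem IsLinked.symm {ε : ℝ} {x y : X} (h : IsLinked ε x y) : IsLinked ε y x := by
  obtain ⟨V, h1, h2, h3, h4, h5⟩ := h
  exact ⟨V, h1, h2, h4, h3, h5⟩

theorem IsLinked.dist_le {ε : ℝ} {x y : X} (h : IsLinked ε x y) : dist x y ≤ ε := by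
  obtain ⟨V, -, -, h3, h4, h5⟩ := h
  exact h5 _ h3 _ h4

theorem exists_linked_nhd [LocallyConnectedSpace X] {ε : ℝ} (hε : 0 < ε) {x : X} {U : Set X}
    (hU : U ∈ 𝓝 x) : ∃ V ⊆ U, IsOpen V ∧ IsPreconnected V ∧ x ∈ V ∧
      ∀ a ∈ V, ∀ b ∈ V, dist a b ≤ ε := by
  have hU' : U ∩ Metric.ball x (ε / 2) ∈ 𝓝 x :=
    Filter.inter_mem hU (Metric.ball_mem_nhds x (by positivity))
  obtain ⟨V, hVU, hVo, hxV, hVc⟩ := locallyConnectedSpace_iff_subsets_isOpen_isConnected.1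
    inferInstance x _ hU'
  refine ⟨V, fun z hz => (hVU hz).1, hVo, hVc.isPreconnected, hxV, fun a ha b hb => ?_⟩
  have h1 := (hVU ha).2
  have h2 := (hVU hb).2
  rw [Metric.mem_ball] at h1 h2
  linarith [dist_triangle_right a b x]

theorem isLinked_refl [LocallyConnectedSpace X] {ε : ℝ} (hε : 0 < ε) (x : X) :
    IsLinked ε x x := by
  obtain ⟨V, -, h1, h2, h3, h4⟩ := exists_linked_nhd hε (x := x) Filter.univ_mem
  exact ⟨V, h1, h2, h3, h3, h4⟩

/-- Linked points are joined by chains of finer links which do not go far away; the chains may be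
chosen of any sufficiently large length. -/
theorem IsLinked.exists_chain [LocallyConnectedSpace X] {ε δ : ℝ} (hδ : 0 < δ) {x y : X}
    (h : IsLinked ε x y) : ∃ m : ℕ, ∃ z : ℕ → X, z 0 = x ∧ (∀ j, m ≤ j → z j = y) ∧
      ∀ j, IsLinked δ (z j) (z (j + 1)) ∧ dist (z j) x ≤ ε := by
  obtain ⟨V, hVo, hVc, hx, hy, hV⟩ := h
  let S : X → X → Prop := fun a b => a ∈ V ∧ b ∈ V ∧ IsLinked δ a b
  have key : Relation.ReflTransGen S x y := by
    -- A symmetric transitive relation that holds between each point and its neighbours holds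
    -- throughout a connected set.
    refine hVc.induction₂ (fun a b => Relation.ReflTransGen S a b) (fun a ha => ?_)
      (fun a b c _ _ _ h1 h2 => h1.trans h2) (fun a b _ _ h => ?_) hx hy
    · obtain ⟨W, hWV, hWo, hWc, haW, hW⟩ := exists_linked_nhd hδ (hVo.mem_nhds ha)
      filter_upwards [mem_nhdsWithin_of_mem_nhds (hWo.mem_nhds haW)] with b hb
      exact Relation.ReflTransGen.single ⟨ha, hWV hb, W, hWo, hWc, haW, hb, hW⟩
    · have : Std.Symm S := ⟨fun a b hab => ⟨hab.2.1, hab.1, hab.2.2.symm⟩⟩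
      exact Relation.ReflTransGen.stdSymm.symm _ _ h
  suffices ∃ m : ℕ, ∃ z : ℕ → X, z 0 = x ∧ (∀ j, m ≤ j → z j = y) ∧
      ∀ j, IsLinked δ (z j) (z (j + 1)) ∧ z j ∈ V by
    obtain ⟨m, z, h1, h2, h3⟩ := this
    exact ⟨m, z, h1, h2, fun j => ⟨(h3 j).1, hV _ (h3 j).2 _ hx⟩⟩
  clear hy
  induction key with
  | refl => exact ⟨0, fun _ => x, rfl, fun _ _ => rfl, fun _ => ⟨isLinked_refl hδ x, hx⟩⟩
  | @tail b c _ hbc ih =>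
    obtain ⟨m, z, h1, h2, h3⟩ := ih
    refine ⟨m + 1, fun j => if j ≤ m then z j else c, by simp [h1], fun j hj => ?_, fun j => ?_⟩
    · simp [show ¬ j ≤ m by omega]
    · rcases lt_trichotomy j m with hj | rfl | hj
      · simp only [hj.le, if_true, show j + 1 ≤ m by omega]
        exact h3 j
      · simp only [le_refl, if_true, show ¬ j + 1 ≤ j by omega, if_false]
        rw [h2 j le_rfl]
        exact ⟨hbc.2.2, hbc.1⟩
      · simp only [show ¬ j ≤ m by omega, show ¬ j + 1 ≤ m by omega, if_false]
        exact ⟨isLinked_refl hδ c, hbc.2.1⟩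

/-- A finite chain of `k` `ε`-links from `x` to `y`. -/
structure LinkChain (ε : ℝ) (x y : X) where
  len : ℕ
  pt : ℕ → X
  len_pos : 0 < len
  pt_zero : pt 0 = x
  pt_eq : ∀ i, len ≤ i → pt i = y
  linked : ∀ i, IsLinked ε (pt i) (pt (i + 1))

/-- Every link is replaced by the same number `m` of finer links. Index `l` of the new chain then
lies over index `l / m` of the old one, so both chains can be read as step functions of one time
parameter. -/
theorem LinkChain.exists_refinement [LocallyConnectedSpace X] {ε δ : ℝ} (hε : 0 < ε) (hδ : 0 < δ)
    {x y : X} (c : LinkChain ε x y) : ∃ d : LinkChain δ x y, ∃ m : ℕ, 0 < m ∧ d.len = c.len * m ∧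
      ∀ l, dist (d.pt l) (c.pt (l / m)) ≤ ε := by
  have hz : ∀ i, ∃ m : ℕ, ∃ z : ℕ → X, (c.len ≤ i → ∀ j, z j = y) ∧ z 0 = c.pt i ∧
      (∀ j, m ≤ j → z j = c.pt (i + 1)) ∧
      ∀ j, IsLinked δ (z j) (z (j + 1)) ∧ dist (z j) (c.pt i) ≤ ε := by
    intro i
    by_cases hi : c.len ≤ i
    · refine ⟨0, fun _ => y, fun _ _ => rfl, (c.pt_eq i hi).symm,
        fun _ _ => (c.pt_eq (i + 1) (by omega)).symm, fun j => ⟨isLinked_refl hδ y, ?_⟩⟩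
      rw [c.pt_eq i hi, dist_self]
      exact hε.le
    · obtain ⟨m, z, h⟩ := (c.linked i).exists_chain hδ
      exact ⟨m, z, fun h => absurd h hi, h⟩
  choose m z hy h0 hm hl using hz
  let M := (Finset.range c.len).sup m + 1
  have hM : ∀ i, z i M = c.pt (i + 1) := by
    intro i
    by_cases hi : c.len ≤ i
    · rw [hy i hi, c.pt_eq _ (by omega)]
    · exact hm i M ((Finset.le_sup (f := m) (Finset.mem_range.2 (not_le.1 hi))).trans
        (Nat.le_succ _))
  have hMpos : 0 < M := Nat.succ_pos _
  refine ⟨⟨c.len * M, fun l => z (l / M) (l % M), Nat.mul_pos c.len_pos hMpos, ?_, ?_, ?_⟩,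
    M, hMpos, rfl, fun l => (hl _ _).2⟩
  · simp [h0, c.pt_zero]
  · intro i hi
    exact hy _ ((Nat.le_div_iff_mul_le hMpos).2 hi) _
  · intro l
    have h1 := Nat.div_add_mod l M
    have h2 := Nat.mod_lt l hMpos
    rcases Nat.lt_or_ge (l % M + 1) M with h | h
    · have e : l + 1 = (l % M + 1) + M * (l / M) := by omega
      have e1 : (l + 1) / M = l / M := by
        rw [e, Nat.add_mul_div_left _ _ hMpos, Nat.div_eq_of_lt h, zero_add]
      have e2 : (l + 1) % M = l % M + 1 := by
        rw [e, Nat.add_mul_mod_self_left, Nat.mod_eq_of_lt h]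
      rw [e1, e2]
      exact (hl _ _).1
    · have e : l + 1 = M * (l / M + 1) := by rw [Nat.mul_add]; omega
      have e1 : (l + 1) / M = l / M + 1 := by rw [e, Nat.mul_div_cancel_left _ hMpos]
      have e2 : (l + 1) % M = 0 := by rw [e, Nat.mul_mod_right]
      rw [e1, e2, h0, ← hM]
      have h3 : M = l % M + 1 := by omega
      have h4 := (hl (l / M) (l % M)).1
      rwa [← h3] at h4

/-- In a complete locally connected metric space, linked points are joined by a path which does not
go far away. -/
theorem IsLinked.joinedIn_closedBall [CompleteSpace X] [LocallyConnectedSpace X] {ε : ℝ}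
    (hε : 0 < ε) {x y : X} (h : IsLinked ε x y) : JoinedIn (Metric.closedBall x (3 * ε)) x y := by
  let e : ℕ → ℝ := fun n => ε / 2 ^ n
  have he : ∀ n, 0 < e n := fun n => by positivity
  let c0 : LinkChain (e 0) x y :=
    ⟨1, fun i => if i = 0 then x else y, one_pos, rfl, fun i hi => by simp; omega, fun i => by
      by_cases hi : i = 0
      · simpa [hi, e] using h
      · simpa [hi] using isLinked_refl (he 0) y⟩
  choose next mul hmul hlen hdist using fun (n : ℕ) (c : LinkChain (e n) x y) =>
    c.exists_refinement (he n) (he (n + 1))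
  let c : ∀ n, LinkChain (e n) x y := fun n => Nat.rec c0 next n
  have hc : ∀ n, c (n + 1) = next n (c n) := fun n => rfl
  -- The `n`-th chain, run through uniformly in unit time. Equal subdivision makes successive step
  -- functions differ by at most `e n`, so they converge uniformly.
  let g : ℕ → ℝ → X := fun n t => (c n).pt ⌊((c n).len : ℝ) * t⌋₊
  have hg : ∀ n t, dist (g n t) (g (n + 1) t) ≤ 2 * ε / 2 / 2 ^ n := by
    intro n t
    have h1 := hdist n (c n) ⌊((c (n + 1)).len : ℝ) * t⌋₊
    have h2 : ⌊((c (n + 1)).len : ℝ) * t⌋₊ / mul n (c n) = ⌊((c n).len : ℝ) * t⌋₊ := by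
      rw [← Nat.floor_div_natCast, hc, hlen]
      have : (0 : ℝ) < mul n (c n) := by exact_mod_cast hmul n (c n)
      congr 1
      push_cast
      field_simp
    rw [h2] at h1
    rw [dist_comm, mul_div_cancel_left₀ _ two_ne_zero]
    exact h1
  choose G hG using fun t => cauchySeq_tendsto_of_complete
    (cauchySeq_of_le_geometric_two (fun n => hg n t))
  have hGd : ∀ n t, dist (g n t) (G t) ≤ 2 * e n := by
    intro n t
    have := dist_le_of_le_geometric_two_of_tendsto (fun n => hg n t) (hG t) n
    simpa [e, mul_div_assoc] using this
  -- The step functions are not continuous, but move by at most `e n` between times less than one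
  -- step apart. With two errors `2 * e n` for passing to the limit, this gives the factor `5`.
  have hGc : ContinuousOn G (Icc 0 1) := by
    intro s hs
    rw [Metric.continuousWithinAt_iff]
    intro η hη
    obtain ⟨n, hn⟩ : ∃ n, 5 * e n < η := by
      have : Tendsto (fun n : ℕ => 5 * (ε * (1 / 2) ^ n)) atTop (𝓝 (5 * (ε * 0))) :=
        ((tendsto_pow_atTop_nhds_zero_of_lt_one (by norm_num) (by norm_num)).const_mul ε).const_mul 5
      rw [mul_zero, mul_zero] at this
      obtain ⟨n, hn⟩ := (this.eventually (gt_mem_nhds hη)).exists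
      refine ⟨n, ?_⟩
      simpa [e, div_eq_mul_inv] using hn
    have hk : (0 : ℝ) < (c n).len := by exact_mod_cast (c n).len_pos
    have close : ∀ a b : ℝ, 0 ≤ a → a ≤ b → b < a + 1 / (c n).len → dist (g n a) (g n b) ≤ e n := by
      intro a b ha hab hb
      have h1 : ⌊((c n).len : ℝ) * a⌋₊ ≤ ⌊((c n).len : ℝ) * b⌋₊ :=
        Nat.floor_le_floor (by gcongr)
      have h2 : ⌊((c n).len : ℝ) * b⌋₊ ≤ ⌊((c n).len : ℝ) * a⌋₊ + 1 := by
        rw [← Nat.floor_add_one (by positivity)]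
        refine Nat.floor_le_floor ?_
        calc ((c n).len : ℝ) * b ≤ (c n).len * (a + 1 / (c n).len) := by gcongr
          _ = _ := by field_simp
      have h3 : ⌊((c n).len : ℝ) * b⌋₊ = ⌊((c n).len : ℝ) * a⌋₊ ∨
        ⌊((c n).len : ℝ) * b⌋₊ = ⌊((c n).len : ℝ) * a⌋₊ + 1 := by omega
      simp only [g]
      rcases h3 with h3 | h3 <;> rw [h3]
      · rw [dist_self]; exact (he n).le
      · exact ((c n).linked _).dist_le
    refine ⟨1 / (c n).len, by positivity, fun t ht hts => ?_⟩
    have h1 : dist (g n t) (g n s) ≤ e n := by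
      rw [Real.dist_eq, abs_lt] at hts
      rcases le_total t s with h | h
      · exact close t s ht.1 h (by linarith)
      · rw [dist_comm]
        exact close s t hs.1 h (by linarith)
    have h2 := hGd n t
    have h3 := hGd n s
    have h4 := dist_triangle4 (G t) (g n t) (g n s) (G s)
    rw [dist_comm (G t) (g n t)] at h4
    linarith
  have hG0 : G 0 = x := tendsto_nhds_unique (hG 0) (by simp [g, (c _).pt_zero])
  have hG1 : G 1 = y := tendsto_nhds_unique (hG 1) (by simp [g, (c _).pt_eq])
  refine JoinedIn.ofLine hGc hG0 hG1 ?_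
  rintro _ ⟨t, -, rfl⟩
  rw [Metric.mem_closedBall]
  have h1 := hGd 0 t
  -- The coarsest chain takes only the values `x` and `y`; adding the limit error `2 * ε` gives the
  -- radius `3 * ε`.
  have h2 : dist (g 0 t) x ≤ ε := by
    show dist (if ⌊((1 : ℕ) : ℝ) * t⌋₊ = 0 then x else y) x ≤ ε
    split_ifs
    · rw [dist_self]; exact hε.le
    · rw [dist_comm]; exact h.dist_le
  have h3 : e 0 = ε := by simp [e]
  rw [h3] at h1
  linarith [dist_triangle_left (G t) x (g 0 t)]

/-- A connected open subset of a complete locally connected metric space is path connected. -/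
theorem IsOpen.joinedIn_of_isPreconnected [CompleteSpace X] [LocallyConnectedSpace X] {U : Set X}
    (hU : IsOpen U) (hc : IsPreconnected U) {x y : X} (hx : x ∈ U) (hy : y ∈ U) :
    JoinedIn U x y := by
  refine hc.induction₂ (fun a b => JoinedIn U a b) (fun a ha => ?_)
      (fun a b c _ _ _ h1 h2 => h1.trans h2) (fun a b _ _ h => h.symm) hx hy
  obtain ⟨r, hr, hrU⟩ := Metric.isOpen_iff.1 hU a ha
  obtain ⟨W, -, hWo, hWc, haW, hW⟩ :=
    exists_linked_nhd (ε := r / 4) (by positivity) (hU.mem_nhds ha)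
  filter_upwards [mem_nhdsWithin_of_mem_nhds (hWo.mem_nhds haW)] with b hb
  have : IsLinked (r / 4) a b := ⟨W, hWo, hWc, haW, hb, hW⟩
  refine (this.joinedIn_closedBall (by positivity)).mono ?_
  exact (Metric.closedBall_subset_ball (by linarith)).trans hrU

end PathsInLocallyConnectedSpaces

/-! ### Extracting an arc from a path by erasing loops. -/

section Arcs

/-- `A` is an arc from `x` to `y`; it is a single point if `x = y`. -/
def IsArc {X : Type u} [TopologicalSpace X] (A : Set X) (x y : X) : Prop :=
  ∃ (b : ℝ) (γ : ℝ → X), 0 ≤ b ∧ ContinuousOn γ (Icc 0 b) ∧ InjOn γ (Icc 0 b) ∧ γ 0 = x ∧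
    γ b = y ∧ γ '' Icc 0 b = A

/-- A closed set of times, containing both ends, such that the path `γ` takes the same value at
both ends of every gap. Leaving out the gaps erases loops of `γ`. -/
structure IsLoopErasing {X : Type u} (γ : ℝ → X) (A : Set ℝ) : Prop where
  isClosed : IsClosed A
  subset : A ⊆ Icc 0 1
  zero_mem : 0 ∈ A
  one_mem : 1 ∈ A
  gap : ∀ s ∈ A, ∀ t ∈ A, s < t → Disjoint (Ioo s t) A → γ s = γ t

variable {X : Type u}

/-- Zorn's lemma. The delicate point is that the gap condition survives intersections of chains,
which follows from compactness and the Hausdorff property. -/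
theorem exists_minimal_isLoopErasing [TopologicalSpace X] [T2Space X] {γ : ℝ → X}
    (hγ : Continuous γ) : ∃ A, Minimal (IsLoopErasing γ) A := by
  refine (zorn_superset_nonempty {A | IsLoopErasing γ A} ?_ (Icc 0 1) ?_).imp fun A h => h.2
  · intro c hc hchain hne
    have hB : ∀ {x}, x ∈ ⋂₀ c ↔ ∀ A ∈ c, x ∈ A := mem_sInter
    refine ⟨⋂₀ c, ⟨isClosed_sInter fun A hA => (hc hA).isClosed, ?_,
      hB.2 fun A hA => (hc hA).zero_mem, hB.2 fun A hA => (hc hA).one_mem, ?_⟩,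
      fun A hA => sInter_subset_of_mem hA⟩
    · obtain ⟨A, hA⟩ := hne
      exact (sInter_subset_of_mem hA).trans (hc hA).subset
    · intro s hs t ht hst hgap
      by_contra hne'
      obtain ⟨U, V, hU, hV, hsU, htV, hUV⟩ := t2_separation hne'
      obtain ⟨ε₁, hε₁, h₁⟩ := Metric.isOpen_iff.1 (hU.preimage hγ) s hsU
      obtain ⟨ε₂, hε₂, h₂⟩ := Metric.isOpen_iff.1 (hV.preimage hγ) t htV
      set η := min (min ε₁ ε₂) (t - s) / 3 with hη
      have hη0 : 0 < η := by
        have : 0 < t - s := sub_pos.2 hst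
        positivity
      have hm1 := min_le_left (min ε₁ ε₂) (t - s)
      have hm2 := min_le_right (min ε₁ ε₂) (t - s)
      have hm3 := min_le_left ε₁ ε₂
      have hm4 := min_le_right ε₁ ε₂
      -- If every member of the chain met this compact interval, so would the intersection, although
      -- it has no point between `s` and `t`.
      obtain ⟨A, hA, hdisj⟩ : ∃ A ∈ c, Disjoint (Icc (s + η) (t - η)) A := by
        by_contra! hcon
        have : (⋂₀ ((fun A => Icc (s + η) (t - η) ∩ A) '' c)).Nonempty := by
          have : Nonempty ((fun A => Icc (s + η) (t - η) ∩ A) '' c) := (hne.image _).to_subtype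
          refine IsCompact.nonempty_sInter_of_directed_nonempty_isCompact_isClosed ?_ ?_ ?_ ?_
          · rintro _ ⟨A, hA, rfl⟩ _ ⟨B, hB, rfl⟩
            rcases hchain.total hA hB with h | h
            · exact ⟨_, ⟨A, hA, rfl⟩, subset_rfl, inter_subset_inter_right _ h⟩
            · exact ⟨_, ⟨B, hB, rfl⟩, inter_subset_inter_right _ h, subset_rfl⟩
          · rintro _ ⟨A, hA, rfl⟩
            exact not_disjoint_iff_nonempty_inter.1 (hcon A hA)
          · rintro _ ⟨A, hA, rfl⟩
            exact isCompact_Icc.inter_right (hc hA).isClosed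
          · rintro _ ⟨A, hA, rfl⟩
            exact isClosed_Icc.inter (hc hA).isClosed
        obtain ⟨x, hx⟩ := this
        have hx' : ∀ A ∈ c, x ∈ Icc (s + η) (t - η) ∩ A := fun A hA => hx _ ⟨A, hA, rfl⟩
        obtain ⟨A₀, hA₀⟩ := hne
        have h3 := (hx' A₀ hA₀).1
        exact disjoint_left.1 hgap (show x ∈ Ioo s t from ⟨by linarith [h3.1], by linarith [h3.2]⟩)
          (hB.2 fun A hA => (hx' A hA).2)
      have hAc := (hc hA).isClosed
      have hsA := hB.1 hs A hA
      have htA := hB.1 ht A hA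
      -- The last time of `A` near `s` and the first one near `t` bound a gap of `A`; `γ` agrees
      -- there, yet takes values in the disjoint sets `U` and `V`.
      obtain ⟨a, ⟨haA, has, ha'⟩, hamax⟩ := ((isCompact_Icc (a := s) (b := s + η)).inter_left
        hAc).exists_isGreatest ⟨s, hsA, le_rfl, by linarith⟩
      obtain ⟨b, ⟨hbA, hb', hbt⟩, hbmin⟩ := ((isCompact_Icc (a := t - η) (b := t)).inter_left
        hAc).exists_isLeast ⟨t, htA, by linarith, le_rfl⟩
      have hab : γ a = γ b := by
        refine (hc hA).gap a haA b hbA (by linarith) (disjoint_left.2 fun x hx hxA => ?_)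
        by_cases h3 : x ≤ s + η
        · exact absurd (hamax ⟨hxA, by linarith [hx.1], h3⟩) (not_le.2 hx.1)
        · by_cases h4 : t - η ≤ x
          · exact absurd (hbmin ⟨hxA, h4, by linarith [hx.2]⟩) (not_le.2 hx.2)
          · exact disjoint_left.1 hdisj ⟨by linarith, by linarith⟩ hxA
      have haU : γ a ∈ U := h₁ (by
        rw [Metric.mem_ball, Real.dist_eq, abs_lt]; constructor <;> linarith)
      have hbV : γ b ∈ V := h₂ (by
        rw [Metric.mem_ball, Real.dist_eq, abs_lt]; constructor <;> linarith)
      exact disjoint_left.1 hUV haU (hab ▸ hbV)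
  · refine ⟨isClosed_Icc, subset_rfl, by simp, by simp, fun s hs t ht hst h => ?_⟩
    exact (disjoint_left.1 h (show (s + t) / 2 ∈ Ioo s t from ⟨by linarith, by linarith⟩)
      ⟨by linarith [hs.1, ht.1], by linarith [hs.2, ht.2]⟩).elim

/-- Otherwise the times between `s` and `t` could be discarded: the only new gap is the one from `s`
to `t`, where `γ` agrees at the ends. This contradicts minimality. -/
theorem Minimal.disjoint_Ioo_of_eq {γ : ℝ → X} {A : Set ℝ} (hA : Minimal (IsLoopErasing γ) A)
    {s t : ℝ} (hs : s ∈ A) (ht : t ∈ A) (h : γ s = γ t) : Disjoint (Ioo s t) A := by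
  have h1 : IsLoopErasing γ (A \ Ioo s t) := by
    refine ⟨hA.prop.isClosed.sdiff isOpen_Ioo, sdiff_subset.trans hA.prop.subset,
      ⟨hA.prop.zero_mem, fun h0 => _root_.not_lt.2 (hA.prop.subset hs).1 h0.1⟩,
      ⟨hA.prop.one_mem, fun h0 => _root_.not_lt.2 (hA.prop.subset ht).2 h0.2⟩, ?_⟩
    intro p hp q hq hpq hgap
    by_cases hd : Disjoint (Ioo p q) A
    · exact hA.prop.gap p hp.1 q hq.1 hpq hd
    · obtain ⟨r, hr, hrA⟩ := not_disjoint_iff.1 hd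
      have hr' : r ∈ Ioo s t := by
        by_contra h0
        exact disjoint_left.1 hgap hr ⟨hrA, h0⟩
      have hps : p ≤ s := by
        by_contra! h0
        exact hp.2 ⟨h0, hr.1.trans hr'.2⟩
      have htq : t ≤ q := by
        by_contra! h0
        exact hq.2 ⟨hr'.1.trans hr.2, h0⟩
      have hps' : p = s := by
        by_contra h0
        exact disjoint_left.1 hgap ⟨lt_of_le_of_ne hps h0, hr'.1.trans hr.2⟩ ⟨hs, fun h => lt_irrefl _ h.1⟩
      have htq' : q = t := by
        by_contra h0
        exact disjoint_left.1 hgap ⟨hr.1.trans hr'.2, lt_of_le_of_ne htq (Ne.symm h0)⟩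
          ⟨ht, fun h => lt_irrefl _ h.2⟩
      rw [hps', htq', h]
  have h2 := hA.le_of_le h1 sdiff_subset
  exact disjoint_right.2 fun x hx => (h2 hx).2

/-- The running maximum of `h` along the set `A`. -/
noncomputable def runningSup (A : Set ℝ) (h : ℝ → ℝ) (t : ℝ) : ℝ :=
  sSup (h '' (A ∩ Iic t))

section runningSup

variable {A : Set ℝ} {h : ℝ → ℝ} {C : ℝ}

theorem le_runningSup (hC : ∀ s ∈ A, h s ≤ C) {s t : ℝ} (hs : s ∈ A) (hst : s ≤ t) :
    h s ≤ runningSup A h t :=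
  le_csSup ⟨C, by rintro _ ⟨x, hx, rfl⟩; exact hC x hx.1⟩ ⟨s, ⟨hs, hst⟩, rfl⟩

theorem runningSup_le {t D : ℝ} (h0 : (A ∩ Iic t).Nonempty)
    (hD : ∀ s ∈ A, s ≤ t → h s ≤ D) : runningSup A h t ≤ D :=
  csSup_le (h0.image _) (by rintro _ ⟨x, hx, rfl⟩; exact hD x hx.1 hx.2)

theorem runningSup_mono (hC : ∀ s ∈ A, h s ≤ C) {s t : ℝ} (hs : s ∈ A) (hst : s ≤ t) :
    runningSup A h s ≤ runningSup A h t :=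
  runningSup_le ⟨s, hs, self_mem_Iic⟩ fun _ hr hrs => le_runningSup hC hr (hrs.trans hst)

theorem continuousOn_runningSup (hA : IsCompact A) (hh : Continuous h) :
    ContinuousOn (runningSup A h) A := by
  obtain ⟨C, hC⟩ : ∃ C, ∀ s ∈ A, h s ≤ C := by
    obtain ⟨C, hC⟩ := hA.bddAbove_image hh.continuousOn
    exact ⟨C, fun s hs => hC ⟨s, hs, rfl⟩⟩
  intro t ht
  rw [Metric.continuousWithinAt_iff]
  intro η hη
  obtain ⟨δ, hδ, hd⟩ := Metric.continuous_iff.1 hh t (η / 3) (by positivity)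
  have key : ∀ a ∈ A, ∀ b ∈ A, dist a t < δ → dist b t < δ → a ≤ b →
      runningSup A h b < runningSup A h a + η := by
    intro a ha b hb hat hbt hab
    have : runningSup A h b ≤ runningSup A h a + 2 * (η / 3) := by
      refine runningSup_le ⟨b, hb, self_mem_Iic⟩ fun s hs hsb => ?_
      rcases le_total s a with h1 | h1
      · linarith [le_runningSup hC hs h1]
      · have h2 : dist s t < δ := by
          rw [Real.dist_eq, abs_lt] at *
          constructor <;> linarith
        have h3 := hd s h2
        have h4 := hd a hat
        have h5 := le_runningSup hC ha (le_refl a)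
        rw [Real.dist_eq, abs_lt] at h3 h4
        linarith
    linarith
  refine ⟨δ, hδ, fun s hs hst => ?_⟩
  have htt : dist t t < δ := by rwa [dist_self]
  rw [Real.dist_eq, abs_lt]
  rcases le_total s t with h1 | h1
  · have := key s hs t ht hst htt h1
    have := runningSup_mono hC hs h1
    constructor <;> linarith
  · have := key t ht s hs htt hst h1
    have := runningSup_mono hC ht h1
    constructor <;> linarith

end runningSup

/-- A reparametrization of a path without loops: a monotone function of time which increases as
long as the path moves. -/
theorem Minimal.exists_reparametrization [MetricSpace X] {γ : ℝ → X} (hγ : Continuous γ)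
    {A : Set ℝ} (hA : Minimal (IsLoopErasing γ) A) : ∃ φ : ℝ → ℝ, ContinuousOn φ A ∧
      MonotoneOn φ A ∧ ∀ s ∈ A, ∀ t ∈ A, φ s = φ t ↔ γ s = γ t := by
  have hAc : IsCompact A := isCompact_Icc.of_isClosed_subset hA.prop.isClosed hA.prop.subset
  have : Nonempty A := ⟨⟨0, hA.prop.zero_mem⟩⟩
  let d : ℕ → A := TopologicalSpace.denseSeq A
  -- Zero up to time `d n`, afterwards the distance travelled from `γ (d n)`. The reparametrization
  -- is the weighted sum of the running maxima of these functions over a dense set of times.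
  let h : ℕ → ℝ → ℝ := fun n s => dist (γ (d n)) (γ (max s (d n)))
  have hh : ∀ n, Continuous (h n) := fun n => by fun_prop
  obtain ⟨C, hC⟩ : ∃ C, ∀ s ∈ A, ∀ t ∈ A, dist (γ s) (γ t) ≤ C := by
    obtain ⟨C, hC⟩ := Metric.isBounded_iff.1 (hAc.image hγ).isBounded
    exact ⟨C, fun s hs t ht => hC ⟨s, hs, rfl⟩ ⟨t, ht, rfl⟩⟩
  have hmax : ∀ n, ∀ s ∈ A, max s (d n) ∈ A := fun n s hs => by
    rcases max_choice s (d n) with h | h <;> rw [h]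
    exacts [hs, (d n).2]
  have hhC : ∀ n, ∀ s ∈ A, h n s ≤ C := fun n s hs => hC _ (d n).2 _ (hmax n s hs)
  let ψ : ℕ → ℝ → ℝ := fun n => runningSup A (h n)
  have hψ0 : ∀ n, ∀ s ∈ A, 0 ≤ ψ n s := fun n s hs =>
    dist_nonneg.trans (le_runningSup (hhC n) hs le_rfl)
  have hψC : ∀ n, ∀ s ∈ A, ψ n s ≤ C := fun n s hs =>
    runningSup_le ⟨s, hs, self_mem_Iic⟩ fun r hr _ => hhC n r hr
  have hbound : ∀ n, ∀ s ∈ A, ‖(1 / 2 : ℝ) ^ n * ψ n s‖ ≤ (1 / 2 : ℝ) ^ n * C := fun n s hs => by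
    rw [Real.norm_of_nonneg (mul_nonneg (by positivity) (hψ0 n s hs))]
    exact mul_le_mul_of_nonneg_left (hψC n s hs) (by positivity)
  have hsumC : Summable fun n => (1 / 2 : ℝ) ^ n * C := summable_geometric_two.mul_right C
  have hsum : ∀ s ∈ A, Summable fun n => (1 / 2 : ℝ) ^ n * ψ n s := fun s hs =>
    hsumC.of_norm_bounded fun n => hbound n s hs
  have hmono : ∀ n, ∀ s ∈ A, ∀ t, s ≤ t → (1 / 2 : ℝ) ^ n * ψ n s ≤ (1 / 2 : ℝ) ^ n * ψ n t :=
    fun n s hs t hst => mul_le_mul_of_nonneg_left (runningSup_mono (hhC n) hs hst) (by positivity)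
  have hlt : ∀ s ∈ A, ∀ t ∈ A, s < t → γ s ≠ γ t →
      ∑' n, (1 / 2 : ℝ) ^ n * ψ n s < ∑' n, (1 / 2 : ℝ) ^ n * ψ n t := by
    intro s hs t ht hst hne
    have hex : ∀ a ∈ A, ∀ b ∈ A, a < b → γ a ≠ γ b → ∃ r ∈ A, r ∈ Ioo a b := by
      intro a ha b hb hab hne
      obtain ⟨r, hr, hrA⟩ := not_disjoint_iff.1 (fun hd => hne (hA.prop.gap a ha b hb hab hd))
      exact ⟨r, hrA, hr⟩
    -- This makes `O` nonempty, so some dense time `d n` lies in it; the `n`-th running maximum is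
    -- then zero at `s` and positive at `t`.
    obtain ⟨r, hrA, hr, hrt⟩ : ∃ r ∈ A, r ∈ Ioo s t ∧ γ r ≠ γ t := by
      obtain ⟨r, hrA, hr⟩ := hex s hs t ht hst hne
      by_cases hrt : γ r = γ t
      · obtain ⟨r', hrA', hr'⟩ := hex s hs r hrA hr.1 (by rwa [hrt])
        refine ⟨r', hrA', ⟨hr'.1, hr'.2.trans hr.2⟩, fun h0 => ?_⟩
        exact disjoint_left.1 (hA.disjoint_Ioo_of_eq hrA' ht h0) ⟨hr'.2, hr.2⟩ hrA
      · exact ⟨r, hrA, hr, hrt⟩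
    let O : Set A := {p | (p : ℝ) ∈ Ioo s t ∧ γ p ≠ γ t}
    have hO : IsOpen O := (isOpen_Ioo.preimage continuous_subtype_val).inter
      (isOpen_ne_fun (by fun_prop) continuous_const)
    obtain ⟨_, hpO, n, rfl⟩ := (TopologicalSpace.denseRange_denseSeq A).inter_open_nonempty O hO
      ⟨⟨r, hrA⟩, hr, hrt⟩
    change (d n : ℝ) ∈ Ioo s t ∧ γ (d n) ≠ γ t at hpO
    refine (hsum s hs).tsum_lt_tsum (i := n) (fun m => hmono m s hs t hst.le) ?_ (hsum t ht)
    refine mul_lt_mul_of_pos_left ?_ (by positivity)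
    calc ψ n s ≤ 0 := runningSup_le ⟨s, hs, self_mem_Iic⟩ fun a _ ha => by
          simp only [h]; rw [max_eq_right (ha.trans hpO.1.1.le), dist_self]
      _ < dist (γ (d n)) (γ t) := dist_pos.2 hpO.2
      _ = h n t := by simp only [h]; rw [max_eq_left hpO.1.2.le]
      _ ≤ ψ n t := le_runningSup (hhC n) ht le_rfl
  have heq : ∀ s ∈ A, ∀ t ∈ A, s < t → γ s = γ t → ∀ n, ψ n s = ψ n t := by
    intro s hs t ht hst heq n
    have hd := hA.disjoint_Ioo_of_eq hs ht heq
    refine le_antisymm (runningSup_mono (hhC n) hs hst.le) ?_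
    refine runningSup_le ⟨t, ht, self_mem_Iic⟩ fun a ha hat => ?_
    rcases le_or_gt a s with h1 | h1
    · exact le_runningSup (hhC n) ha h1
    · have hat' : a = t := by
        by_contra h2
        exact disjoint_left.1 hd ⟨h1, lt_of_le_of_ne hat h2⟩ ha
      have h3 : h n a = h n s := by
        rcases le_or_gt (d n : ℝ) s with h4 | h4
        · simp only [h, hat', max_eq_left h4, max_eq_left (h4.trans hst.le), heq]
        · have h5 : t ≤ d n := by
            by_contra! h5
            exact disjoint_left.1 hd ⟨h4, h5⟩ (d n).2
          simp only [h, hat', max_eq_right h5, max_eq_right (hst.le.trans h5)]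
      rw [h3]
      exact le_runningSup (hhC n) hs le_rfl
  refine ⟨fun t => ∑' n, (1 / 2 : ℝ) ^ n * ψ n t, ?_, ?_, ?_⟩
  · exact continuousOn_tsum (fun n => continuousOn_const.mul (continuousOn_runningSup hAc (hh n)))
      hsumC hbound
  · exact fun s hs t ht hst => (hsum s hs).tsum_le_tsum (fun n => hmono n s hs t hst) (hsum t ht)
  · intro s hs t ht
    rcases lt_trichotomy s t with h1 | rfl | h1
    · refine ⟨fun h2 => ?_, fun h2 => ?_⟩
      · by_contra h3
        exact (hlt s hs t ht h1 h3).ne h2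
      · simp only [heq s hs t ht h1 h2]
    · simp
    · refine ⟨fun h2 => ?_, fun h2 => ?_⟩
      · by_contra h3
        exact (hlt t ht s hs h1 (Ne.symm h3)).ne' h2
      · simp only [heq t ht s hs h1 h2.symm]

/-- A path contains an arc with the same ends. -/
theorem exists_isArc_of_continuous [MetricSpace X] {γ : ℝ → X} (hγ : Continuous γ) :
    ∃ A, IsArc A (γ 0) (γ 1) ∧ A ⊆ γ '' Icc 0 1 := by
  obtain ⟨A, hA⟩ := exists_minimal_isLoopErasing hγ
  obtain ⟨φ, hφc, hφm, hφ⟩ := hA.exists_reparametrization hγ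
  have hAc : IsCompact A := isCompact_Icc.of_isClosed_subset hA.prop.isClosed hA.prop.subset
  have h0 := hA.prop.zero_mem
  have h1 := hA.prop.one_mem
  have hmem : ∀ a ∈ A, φ a - φ 0 ∈ Icc 0 (φ 1 - φ 0) := fun a ha =>
    ⟨sub_nonneg.2 (hφm h0 ha (hA.prop.subset ha).1),
      sub_le_sub_right (hφm ha h1 (hA.prop.subset ha).2) _⟩
  -- Although `A` may have gaps, `φ` takes equal values at the ends of each, so its image skips no
  -- value.
  have hsurj : ∀ y ∈ Icc 0 (φ 1 - φ 0), ∃ a ∈ A, φ a - φ 0 = y := by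
    intro y hy
    have hc1 : IsCompact (A ∩ φ ⁻¹' Iic (y + φ 0)) :=
      hAc.of_isClosed_subset (hφc.preimage_isClosed_of_isClosed hA.prop.isClosed isClosed_Iic)
        inter_subset_left
    have hc2 : IsCompact (A ∩ φ ⁻¹' Ici (y + φ 0)) :=
      hAc.of_isClosed_subset (hφc.preimage_isClosed_of_isClosed hA.prop.isClosed isClosed_Ici)
        inter_subset_left
    obtain ⟨a, ⟨haA, ha⟩, hamax⟩ := hc1.exists_isGreatest
      ⟨0, h0, show φ 0 ≤ y + φ 0 by linarith [hy.1]⟩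
    obtain ⟨b, ⟨hbA, hb⟩, hbmin⟩ := hc2.exists_isLeast
      ⟨1, h1, show y + φ 0 ≤ φ 1 by linarith [hy.2]⟩
    change φ a ≤ y + φ 0 at ha
    change y + φ 0 ≤ φ b at hb
    refine ⟨a, haA, ?_⟩
    rcases le_or_gt b a with hab | hab
    · have := hφm hbA haA hab
      linarith
    · have hd : Disjoint (Ioo a b) A := by
        refine disjoint_left.2 fun x hx hxA => ?_
        rcases le_total (φ x) (y + φ 0) with h2 | h2
        · exact absurd (hamax ⟨hxA, h2⟩) (not_le.2 hx.1)
        · exact absurd (hbmin ⟨hxA, h2⟩) (not_le.2 hx.2)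
      have := (hφ a haA b hbA).2 (hA.prop.gap a haA b hbA hab hd)
      linarith
  choose! g hgA hg using hsurj
  have hγg : ∀ a ∈ A, γ (g (φ a - φ 0)) = γ a := fun a ha =>
    (hφ _ (hgA _ (hmem a ha)) _ ha).1 (by linarith [hg _ (hmem a ha)])
  refine ⟨_, ⟨φ 1 - φ 0, γ ∘ g, (hmem 0 h0).2.trans' (by simp), ?_, ?_, ?_, hγg 1 h1, rfl⟩, ?_⟩
  · have : CompactSpace A := isCompact_iff_compactSpace.1 hAc
    let Φ : A → Icc 0 (φ 1 - φ 0) := fun a => ⟨φ a - φ 0, hmem a a.2⟩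
    have hΦ : Continuous Φ :=
      ((continuousOn_iff_continuous_domRestrict.1 hφc).sub continuous_const).subtype_mk _
    -- The section `g` need not be continuous; continuity of `γ ∘ g` descends from that of `γ` on
    -- `A`.
    have hq : IsQuotientMap Φ := hΦ.isClosedMap.isQuotientMap hΦ fun y => by
      refine ⟨⟨g y, hgA _ y.2⟩, Subtype.ext (hg _ y.2)⟩
    rw [continuousOn_iff_continuous_domRestrict, hq.continuous_iff]
    refine (hγ.comp continuous_subtype_val).congr fun a => ?_
    exact (hγg a a.2).symm
  · intro y hy z hz hyz
    rw [← hg y hy, ← hg z hz, (hφ _ (hgA y hy) _ (hgA z hz)).2 hyz]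
  · have := hγg 0 h0
    rwa [sub_self] at this
  · rintro _ ⟨y, hy, rfl⟩
    exact ⟨g y, hA.prop.subset (hgA y hy), rfl⟩

end Arcs

/-! ### Images, reversal, subarcs and concatenation of arcs. -/

section ArcOperations

variable {X : Type u} [TopologicalSpace X] {A B : Set X} {x y z : X}

theorem continuumHull_mono {P Q : Set X} (h : P ⊆ Q) : continuumHull P ⊆ continuumHull Q :=
  sInter_subset_sInter fun _ hK => ⟨hK.1, h.trans hK.2⟩

theorem isArc_image_Icc {γ : ℝ → X} {a b : ℝ} (hab : a ≤ b) (hc : ContinuousOn γ (Icc a b))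
    (hi : InjOn γ (Icc a b)) : IsArc (γ '' Icc a b) (γ a) (γ b) := by
  have hm : MapsTo (fun t => t + a) (Icc 0 (b - a)) (Icc a b) := fun t ht =>
    ⟨by linarith [ht.1], by linarith [ht.2]⟩
  refine ⟨b - a, fun t => γ (t + a), sub_nonneg.2 hab, hc.comp (by fun_prop) hm,
    fun s hs t ht hst => add_right_cancel (hi (hm hs) (hm ht) hst), by simp, by simp, ?_⟩
  have h := image_image γ (fun t => t + a) (Icc 0 (b - a))
  rw [image_add_const_Icc] at h
  simpa using h.symm

theorem IsArc.isCompact (h : IsArc A x y) : IsCompact A := by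
  obtain ⟨b, γ, -, hc, -, -, -, rfl⟩ := h
  exact isCompact_Icc.image_of_continuousOn hc

theorem IsArc.isPreconnected (h : IsArc A x y) : IsPreconnected A := by
  obtain ⟨b, γ, -, hc, -, -, -, rfl⟩ := h
  exact isPreconnected_Icc.image _ hc

theorem IsArc.left_mem (h : IsArc A x y) : x ∈ A := by
  obtain ⟨b, γ, hb, -, -, h0, -, rfl⟩ := h
  exact ⟨0, ⟨le_rfl, hb⟩, h0⟩

theorem IsArc.right_mem (h : IsArc A x y) : y ∈ A := by
  obtain ⟨b, γ, hb, -, -, -, h1, rfl⟩ := h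
  exact ⟨b, ⟨hb, le_rfl⟩, h1⟩

theorem IsArc.isContinuum (h : IsArc A x y) : IsContinuum A :=
  ⟨h.isCompact, ⟨x, h.left_mem⟩, h.isPreconnected⟩

theorem IsArc.image {Y : Type*} [TopologicalSpace Y] {g : X → Y} (h : IsArc A x y)
    (hc : ContinuousOn g A) (hi : InjOn g A) : IsArc (g '' A) (g x) (g y) := by
  obtain ⟨b, γ, hb, hγ, hγi, rfl, rfl, rfl⟩ := h
  exact ⟨b, g ∘ γ, hb, hc.comp hγ (mapsTo_image _ _), hi.comp hγi (mapsTo_image _ _), rfl, rfl,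
    image_comp _ _ _⟩

theorem IsArc.symm (h : IsArc A x y) : IsArc A y x := by
  obtain ⟨b, γ, hb, hγ, hγi, rfl, rfl, rfl⟩ := h
  have hm : MapsTo (fun t => b - t) (Icc 0 b) (Icc 0 b) := fun t ht =>
    ⟨by linarith [ht.2], by linarith [ht.1]⟩
  refine ⟨b, fun t => γ (b - t), hb, hγ.comp (by fun_prop) hm,
    fun s hs t ht hst => sub_right_injective (hγi (hm hs) (hm ht) hst), by simp, by simp, ?_⟩
  have h := image_image γ (fun t => b - t) (Icc 0 b)
  rw [image_const_sub_Icc] at h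
  simpa using h.symm

theorem IsArc.exists_subarc (h : IsArc A x y) {p q : X} (hp : p ∈ A) (hq : q ∈ A) :
    ∃ B ⊆ A, IsArc B p q := by
  obtain ⟨b, γ, hb, hγ, hγi, rfl, rfl, rfl⟩ := h
  obtain ⟨s, hs, rfl⟩ := hp
  obtain ⟨t, ht, rfl⟩ := hq
  rcases le_total s t with hst | hst
  · have hsub := Icc_subset_Icc hs.1 ht.2
    exact ⟨_, image_mono hsub, isArc_image_Icc hst (hγ.mono hsub) (hγi.mono hsub)⟩
  · have hsub := Icc_subset_Icc ht.1 hs.2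
    exact ⟨_, image_mono hsub, (isArc_image_Icc hst (hγ.mono hsub) (hγi.mono hsub)).symm⟩

/-- Two arcs with a common end parametrize a path. -/
theorem IsArc.exists_concat (hA : IsArc A x y) (hB : IsArc B y z) :
    ∃ (a b : ℝ) (γ : ℝ → X), 0 ≤ a ∧ 0 ≤ b ∧ ContinuousOn γ (Icc 0 (a + b)) ∧
      InjOn γ (Icc 0 a) ∧ InjOn γ (Icc a (a + b)) ∧ γ 0 = x ∧ γ a = y ∧ γ (a + b) = z ∧
      γ '' Icc 0 a = A ∧ γ '' Icc a (a + b) = B := by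
  obtain ⟨a, γ, ha, hγ, hγi, hγ0, hγa, rfl⟩ := hA
  obtain ⟨b, δ, hb, hδ, hδi, hδ0, hδb, rfl⟩ := hB
  let F : ℝ → X := fun t => if t ≤ a then γ t else δ (t - a)
  have hF1 : EqOn F γ (Icc 0 a) := fun t ht => if_pos ht.2
  have hF2 : EqOn F (fun t => δ (t - a)) (Icc a (a + b)) := by
    intro t ht
    rcases ht.1.eq_or_lt with rfl | h
    · simp [F, hγa, hδ0]
    · exact if_neg (not_le.2 h)
  have hm : MapsTo (fun t => t - a) (Icc a (a + b)) (Icc 0 b) := fun t ht =>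
    ⟨by linarith [ht.1], by linarith [ht.2]⟩
  have hc1 : ContinuousOn F (Icc 0 a) := hγ.congr hF1
  have hc2 : ContinuousOn F (Icc a (a + b)) :=
    (hδ.comp (by fun_prop) hm).congr hF2
  refine ⟨a, b, F, ha, hb, ?_, hγi.congr hF1.symm, ?_, ?_, ?_, ?_, hF1.image_eq, ?_⟩
  · have := hc1.union_of_isClosed hc2 isClosed_Icc isClosed_Icc
    rwa [Icc_union_Icc_eq_Icc ha (by linarith)] at this
  · refine InjOn.congr (f₁ := fun t => δ (t - a)) (fun s hs t ht hst => ?_) hF2.symm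
    exact sub_left_injective (hδi (hm hs) (hm ht) hst)
  · rw [hF1 ⟨le_rfl, ha⟩, hγ0]
  · rw [hF1 ⟨ha, le_rfl⟩, hγa]
  · rw [hF2 ⟨by linarith, le_rfl⟩]
    simpa using hδb
  · rw [hF2.image_eq]
    have h := image_image δ (fun t => t - a) (Icc a (a + b))
    rw [image_sub_const_Icc] at h
    simpa using h.symm

theorem IsArc.concat (hA : IsArc A x y) (hB : IsArc B y z) (h : A ∩ B ⊆ {y}) :
    IsArc (A ∪ B) x z := by
  obtain ⟨a, b, γ, ha, hb, hc, hi1, hi2, rfl, rfl, rfl, rfl, rfl⟩ := hA.exists_concat hB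
  refine ⟨a + b, γ, by linarith, hc, ?_, rfl, rfl, ?_⟩
  · have key : ∀ s ∈ Icc 0 (a + b), ∀ t ∈ Icc 0 (a + b), s ≤ t → γ s = γ t → s = t := by
      intro s hs t ht hst hγ
      rcases le_total t a with h1 | h1
      · exact hi1 ⟨hs.1, hst.trans h1⟩ ⟨ht.1, h1⟩ hγ
      · rcases le_total a s with h2 | h2
        · exact hi2 ⟨h2, hs.2⟩ ⟨h1, ht.2⟩ hγ
        · have h3 : γ s = γ a := h ⟨⟨s, ⟨hs.1, h2⟩, rfl⟩, ⟨t, ⟨h1, ht.2⟩, hγ.symm⟩⟩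
          rw [hi1 ⟨hs.1, h2⟩ ⟨ha, le_rfl⟩ h3]
          exact hi2 ⟨le_rfl, by linarith⟩ ⟨h1, ht.2⟩ (h3.symm.trans hγ)
    intro s hs t ht hγ
    rcases le_total s t with hst | hst
    · exact key s hs t ht hst hγ
    · exact (key t ht s hs hst hγ.symm).symm
  · rw [← image_union, Icc_union_Icc_eq_Icc ha (by linarith)]

end ArcOperations

/-! ### Unique arcs and continuum hulls in dendrites. -/

section DendriteArcs

variable {X : Type u} [TopologicalSpace X] [Dendrite X] {A B : Set X} {x y z : X}

/-- There are no simple closed curves in a dendrite. -/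
theorem Dendrite.not_simple_loop {γ : ℝ → X} {a b : ℝ} (hab : a < b)
    (hc : ContinuousOn γ (Icc a b)) (hi : InjOn γ (Ico a b)) : γ a ≠ γ b := by
  intro h
  have : Fact (0 < b - a) := ⟨sub_pos.2 hab⟩
  have e : a + (b - a) = b := by ring
  have h1 : Continuous (AddCircle.liftIco (b - a) a γ) :=
    AddCircle.liftIco_continuous (by rwa [e]) (by rwa [e])
  have h2 : Function.Injective (AddCircle.liftIco (b - a) a γ) := by
    intro u v huv
    obtain ⟨s, hs, rfl⟩ : u ∈ ((↑) : ℝ → AddCircle (b - a)) '' Ico a (a + (b - a)) := by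
      rw [AddCircle.coe_image_Ico_eq]; trivial
    obtain ⟨t, ht, rfl⟩ : v ∈ ((↑) : ℝ → AddCircle (b - a)) '' Ico a (a + (b - a)) := by
      rw [AddCircle.coe_image_Ico_eq]; trivial
    rw [AddCircle.liftIco_coe_apply hs, AddCircle.liftIco_coe_apply ht] at huv
    rw [e] at hs ht
    rw [hi hs ht huv]
  let H := AddCircle.homeomorphCircle (T := b - a) (sub_pos.2 hab).ne'
  exact Dendrite.not_isEmbedding_circle (AddCircle.liftIco (b - a) a γ ∘ H.symm)
    ((h1.comp H.symm.continuous).isClosedEmbedding (h2.comp H.symm.injective)).isEmbedding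

/-- If the ends differed, running along `A` and back along `B` would give a simple closed curve. -/
theorem IsArc.eq_of_inter_subset (hA : IsArc A x y) (hB : IsArc B x y) (h : A ∩ B ⊆ {x, y}) :
    x = y := by
  by_contra hne
  obtain ⟨a, b, γ, ha, hb, hc, hi1, hi2, rfl, rfl, h2, rfl, rfl⟩ := hA.exists_concat hB.symm
  have ha0 : 0 < a := ha.lt_of_ne fun h0 => hne (by rw [← h0])
  have hb0 : 0 < b := hb.lt_of_ne fun h0 => hne (by rw [← h2, ← h0, add_zero])
  refine Dendrite.not_simple_loop (by linarith) hc ?_ h2.symm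
  have key : ∀ s ∈ Ico 0 (a + b), ∀ t ∈ Ico 0 (a + b), s ≤ t → γ s = γ t → s = t := by
    intro s hs t ht hst hγ
    rcases le_total t a with h1 | h1
    · exact hi1 ⟨hs.1, hst.trans h1⟩ ⟨ht.1, h1⟩ hγ
    · rcases le_total a s with h3 | h3
      · exact hi2 ⟨h3, hs.2.le⟩ ⟨h1, ht.2.le⟩ hγ
      · rcases h ⟨⟨s, ⟨hs.1, h3⟩, rfl⟩, ⟨t, ⟨h1, ht.2.le⟩, hγ.symm⟩⟩ with h4 | h4
        · exact absurd (hi2 ⟨h1, ht.2.le⟩ ⟨by linarith, le_rfl⟩ (by rw [← hγ, h4, h2])) ht.2.ne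
        · rw [mem_singleton_iff] at h4
          rw [hi1 ⟨hs.1, h3⟩ ⟨ha, le_rfl⟩ h4]
          exact hi2 ⟨le_rfl, by linarith⟩ ⟨h1, ht.2.le⟩ (h4.symm.trans hγ)
  intro s hs t ht hγ
  rcases le_total s t with hst | hst
  · exact key s hs t ht hst hγ
  · exact (key t ht s hs hst hγ.symm).symm

/-- A point of `A` off `B` lies on a maximal excursion of `A` away from the closed set `B`. The
excursion and the subarc of `B` between its ends meet only at those ends, which must then coincide.
-/
theorem IsArc.subset_of_isArc (hA : IsArc A x y) (hB : IsArc B x y) : A ⊆ B := by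
  by_contra hAB
  obtain ⟨_, hzA, hzB⟩ := not_subset.1 hAB
  have hBc : IsClosed B := hB.isCompact.isClosed
  have hx := hB.left_mem
  have hy := hB.right_mem
  obtain ⟨a, γ, ha, hγ, hγi, rfl, rfl, rfl⟩ := hA
  obtain ⟨t, ht, rfl⟩ := hzA
  have hcl : ∀ {p q : ℝ}, 0 ≤ p → q ≤ a → IsCompact (Icc p q ∩ γ ⁻¹' B) := fun hp hq =>
    isCompact_Icc.of_isClosed_subset ((hγ.mono (Icc_subset_Icc hp hq)).preimage_isClosed_of_isClosed
      isClosed_Icc hBc) inter_subset_left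
  obtain ⟨s, ⟨hs, hsB⟩, hsmax⟩ := (hcl le_rfl ht.2).exists_isGreatest ⟨0, ⟨le_rfl, ht.1⟩, hx⟩
  obtain ⟨u, ⟨hu, huB⟩, humin⟩ := (hcl ht.1 le_rfl).exists_isLeast ⟨a, ⟨ht.2, le_rfl⟩, hy⟩
  have hst : s < t := hs.2.lt_of_ne fun h => hzB (h ▸ hsB)
  have htu : t < u := hu.1.lt_of_ne fun h => hzB (h ▸ huB)
  have hsub : Icc s u ⊆ Icc 0 a := Icc_subset_Icc hs.1 hu.2
  obtain ⟨C, hCB, hC⟩ := hB.exists_subarc hsB huB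
  have h1 := isArc_image_Icc (hst.trans htu).le (hγ.mono hsub) (hγi.mono hsub)
  have h2 := h1.eq_of_inter_subset hC (by
    rintro _ ⟨⟨v, hv, rfl⟩, hvC⟩
    have hvB : γ v ∈ B := hCB hvC
    rcases le_total v t with h3 | h3
    · left
      rw [le_antisymm (hsmax ⟨⟨hs.1.trans hv.1, h3⟩, hvB⟩) hv.1]
    · right
      rw [le_antisymm hv.2 (humin ⟨⟨h3, hv.2.trans hu.2⟩, hvB⟩)]
      rfl)
  exact (hst.trans htu).ne (hγi ⟨hs.1, hs.2.trans ht.2⟩ ⟨ht.1.trans hu.1, hu.2⟩ h2)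

/-- Arcs in dendrites are determined by their ends. -/
theorem IsArc.unique (hA : IsArc A x y) (hB : IsArc B x y) : A = B :=
  (hA.subset_of_isArc hB).antisymm (hB.subset_of_isArc hA)

theorem IsOpen.exists_isArc {U : Set X} (hU : IsOpen U) (hc : IsPreconnected U) (hx : x ∈ U)
    (hy : y ∈ U) : ∃ A ⊆ U, IsArc A x y := by
  let := TopologicalSpace.metrizableSpaceMetric X
  have h : JoinedIn U x y := hU.joinedIn_of_isPreconnected hc hx hy
  obtain ⟨A, hA, hAs⟩ := exists_isArc_of_continuous h.somePath.continuous_extend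
  refine ⟨A, hAs.trans ?_, by simpa using hA⟩
  rintro _ ⟨t, ht, rfl⟩
  rw [Path.extend_apply _ ht]
  exact h.somePath_mem _

/-- Connected subsets of a dendrite are arcwise connected. -/
theorem IsArc.subset_of_isPreconnected {S : Set X} (hA : IsArc A x y) (hS : IsPreconnected S)
    (hx : x ∈ S) (hy : y ∈ S) : A ⊆ S := by
  intro z hzA
  -- A component of the complement of `z` is open, so it contains an arc from `x` to `y`, and by
  -- uniqueness that arc is `A`, which passes through `z`.
  by_contra hzS
  have hSz : S ⊆ {z}ᶜ := fun w hw h => hzS (h ▸ hw)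
  have hsub := hS.subset_connectedComponentIn hx hSz
  obtain ⟨B, hB, hBa⟩ := isOpen_compl_singleton.connectedComponentIn.exists_isArc
    isPreconnected_connectedComponentIn (hsub hx) (hsub hy)
  exact connectedComponentIn_subset _ _ (hB (hA.subset_of_isArc hBa hzA)) rfl

/-- The arc is itself a continuum through both ends, and every other such continuum contains it. -/
theorem IsArc.dendriteArc_eq (hA : IsArc A x y) : dendriteArc x y = A := by
  refine Subset.antisymm (sInter_subset_of_mem ⟨hA.isContinuum, ?_⟩) (subset_sInter ?_)
  · exact insert_subset hA.left_mem (singleton_subset_iff.2 hA.right_mem)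
  · rintro K ⟨hK, hxy⟩
    exact hA.subset_of_isPreconnected hK.2.isPreconnected (hxy (by simp)) (hxy (by simp))

theorem isArc_dendriteArc (x y : X) : IsArc (dendriteArc x y) x y := by
  obtain ⟨A, -, hA⟩ := isOpen_univ.exists_isArc isPreconnected_univ (mem_univ x) (mem_univ y)
  rwa [hA.dendriteArc_eq]

theorem dendriteArc_subset {S : Set X} (hS : IsPreconnected S) (hx : x ∈ S) (hy : y ∈ S) :
    dendriteArc x y ⊆ S :=
  (isArc_dendriteArc x y).subset_of_isPreconnected hS hx hy

theorem dendriteArc_image {Y : Type*} [TopologicalSpace Y] [Dendrite Y] {g : X → Y}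
    (hc : ContinuousOn g (dendriteArc x y)) (hi : InjOn g (dendriteArc x y)) :
    g '' dendriteArc x y = dendriteArc (g x) (g y) :=
  ((isArc_dendriteArc x y).image hc hi).dendriteArc_eq.symm

theorem dendriteArc_subset_continuumHull {P : Set X} (hx : x ∈ P) (hy : y ∈ P) :
    dendriteArc x y ⊆ continuumHull P :=
  subset_sInter fun _ hK => dendriteArc_subset hK.1.2.isPreconnected (hK.2 hx) (hK.2 hy)

/-- The continuum hull of a finite set is the union of the arcs between its points. -/
theorem continuumHull_eq_iUnion {P : Set X} (hP : P.Finite) {p : X} (hp : p ∈ P) :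
    continuumHull P = ⋃ q ∈ P, dendriteArc p q := by
  refine Subset.antisymm (sInter_subset_of_mem ⟨⟨?_, ⟨p, ?_⟩, ?_⟩, fun q hq => ?_⟩) ?_
  · exact hP.isCompact_biUnion fun q _ => (isArc_dendriteArc p q).isCompact
  · exact mem_biUnion hp (isArc_dendriteArc p p).left_mem
  · rw [biUnion_eq_iUnion]
    exact isPreconnected_iUnion ⟨p, mem_iInter.2 fun q => (isArc_dendriteArc p q).left_mem⟩
      fun q => (isArc_dendriteArc p q).isPreconnected
  · exact mem_biUnion hq (isArc_dendriteArc p q).right_mem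
  · exact iUnion₂_subset fun q hq => dendriteArc_subset_continuumHull hp hq

/-- Injective continuous maps take continuum hulls to continuum hulls. -/
theorem image_continuumHull {Y : Type*} [TopologicalSpace Y] [Dendrite Y] {g : X → Y} {P : Set X}
    (hP : P.Finite) (hne : P.Nonempty) (hc : ContinuousOn g (continuumHull P))
    (hi : InjOn g (continuumHull P)) : g '' continuumHull P = continuumHull (g '' P) := by
  obtain ⟨p, hp⟩ := hne
  rw [continuumHull_eq_iUnion (hP.image g) (mem_image_of_mem g hp), continuumHull_eq_iUnion hP hp,
    image_iUnion₂, biUnion_image]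
  refine iUnion₂_congr fun q hq => ?_
  have hsub := dendriteArc_subset_continuumHull hp hq
  exact dendriteArc_image (hc.mono hsub) (hi.mono hsub)

end DendriteArcs

/-! ### Reading maps into an arc in its parameter. -/

section LiftToParameter

/-- By compactness the inverse of `γ` is continuous on the arc. This turns self-maps of arcs into
real functions, to which order and intermediate values apply. -/
theorem exists_lift_to_parameter {X : Type u} [TopologicalSpace X] [T2Space X] {γ g : ℝ → X}
    {b : ℝ} {S : Set ℝ} (hc : ContinuousOn γ (Icc 0 b)) (hi : InjOn γ (Icc 0 b))
    (hg : ContinuousOn g S) (hm : MapsTo g S (γ '' Icc 0 b)) :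
    ∃ φ : ℝ → ℝ, ContinuousOn φ S ∧ MapsTo φ S (Icc 0 b) ∧ ∀ s ∈ S, γ (φ s) = g s := by
  replace hm : ∀ s ∈ S, ∃ u ∈ Icc 0 b, γ u = g s := fun s hs => hm hs
  choose! φ hφm hφ using hm
  replace hφm : MapsTo φ S (Icc 0 b) := hφm
  refine ⟨φ, continuousOn_iff_isClosed.2 fun C hC => ?_, hφm, hφ⟩
  obtain ⟨D, hD, h⟩ := continuousOn_iff_isClosed.1 hg (γ '' (Icc 0 b ∩ C))
    ((isCompact_Icc.inter_right hC).image_of_continuousOn (hc.mono inter_subset_left)).isClosed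
  refine ⟨D, hD, h ▸ ?_⟩
  ext s
  refine ⟨fun hs => ⟨⟨φ s, ⟨hφm hs.2, hs.1⟩, hφ s hs.2⟩, hs.2⟩, ?_⟩
  rintro ⟨⟨u, hu, hus⟩, hs⟩
  have : u = φ s := hi hu.1 (hφm hs) (hus.trans (hφ s hs).symm)
  exact ⟨show φ s ∈ C from this ▸ hu.2, hs⟩

end LiftToParameter

/-! ### The fibre involution and injectivity away from the critical point. -/

section BranchedCoverings

variable {X : Type u} [TopologicalSpace X] {f : X → X}

/-- The involution which interchanges the points of every fibre of a `2`-to-`1` branched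
covering. -/
theorem IsTwoToOneBranchedCovering.exists_involution [CompactSpace X] [T2Space X]
    (hf : IsTwoToOneBranchedCovering f) : ∃ σ : X → X, Continuous σ ∧ (∀ x, σ (σ x) = x) ∧
      (∀ x y, f x = f y → x ≠ y → y = σ x) ∧ ∀ x, σ x = x ↔ IsCriticalPoint f x := by
  have key : ∀ x, ∃ y, (∀ z, f z = f x ↔ z = x ∨ z = y) ∧ (y = x ↔ IsCriticalPoint f x) := by
    intro x
    by_cases hx : IsCriticalPoint f x
    · refine ⟨x, fun z => ?_, by simp [hx]⟩
      rw [or_self]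
      exact Set.ext_iff.1 (hf.fibre_critical x hx) z
    · have h2 := hf.fibre_regular (f x) fun c hc hcx => by
        have : x ∈ f ⁻¹' {f c} := hcx.symm
        rw [hf.fibre_critical c hc] at this
        exact hx (this ▸ hc)
      obtain ⟨a, b, hab, h⟩ := Set.ncard_eq_two.1 h2
      have h' : ∀ z, f z = f x ↔ z = a ∨ z = b := fun z => Set.ext_iff.1 h z
      rcases (h' x).1 rfl with rfl | rfl
      · exact ⟨b, h', by simp [hx, hab.symm]⟩
      · exact ⟨a, fun z => (h' z).trans or_comm, by simp [hx, hab]⟩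
  choose σ hσ hcrit using key
  have hfσ : ∀ x, f (σ x) = f x := fun x => (hσ x _).2 (Or.inr rfl)
  refine ⟨σ, continuous_iff_continuousAt.2 fun x => ?_, fun x => ?_, fun x y hxy hne => ?_, hcrit⟩
  · rw [ContinuousAt, tendsto_nhds]
    intro V hV hxV
    -- At a fixed point continuity comes from `f` being a closed map; elsewhere from `f` being open,
    -- with the two points of the fibre kept apart by disjoint neighbourhoods.
    by_cases hx : σ x = x
    · have hcl : IsClosed (f '' Vᶜ) := hf.continuous.isClosedMap _ hV.isClosed_compl
      have hxn : f x ∉ f '' Vᶜ := by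
        rintro ⟨v, hv, hvx⟩
        rcases (hσ x v).1 hvx with rfl | rfl
        · rw [hx] at hxV; exact hv hxV
        · exact hv hxV
      filter_upwards [hf.continuous.continuousAt.preimage_mem_nhds (hcl.isOpen_compl.mem_nhds hxn)]
        with z hz
      by_contra hzV
      exact hz ⟨σ z, hzV, hfσ z⟩
    · obtain ⟨U, W, hU, hW, hxU, hxW, hUW⟩ := t2_separation (Ne.symm hx)
      have hop := hf.isOpenMap _ (hV.inter hW)
      have hxm : f x ∈ f '' (V ∩ W) := ⟨σ x, ⟨hxV, hxW⟩, hfσ x⟩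
      filter_upwards [hU.mem_nhds hxU,
        hf.continuous.continuousAt.preimage_mem_nhds (hop.mem_nhds hxm)] with z hzU hz
      obtain ⟨v, hv, hvz⟩ := hz
      rcases (hσ z v).1 hvz with rfl | rfl
      · exact (disjoint_left.1 hUW hzU hv.2).elim
      · exact hv.1
  · rcases (hσ (σ x) x).1 (hfσ x).symm with h | h
    · rw [← h, ← h]
    · exact h.symm
  · exact ((hσ x y).1 hxy.symm).resolve_left hne.symm

variable [Dendrite X]

/-- Two points with the same image are separated by a critical point. -/
theorem IsTwoToOneBranchedCovering.exists_critical_mem_dendriteArc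
    (hf : IsTwoToOneBranchedCovering f) {x y : X} (hxy : f x = f y) (hne : x ≠ y) :
    ∃ c ∈ dendriteArc x y, IsCriticalPoint f c := by
  obtain ⟨σ, hσc, hσσ, hσ, hcrit⟩ := hf.exists_involution
  obtain rfl := hσ x y hxy hne
  have hinj : Function.Injective σ := (show Function.Involutive σ from hσσ).injective
  have hA := isArc_dendriteArc x (σ x)
  have hAσ := hA.image hσc.continuousOn hinj.injOn
  rw [hσσ] at hAσ
  -- The involution swaps the ends of the arc, so preserves it. In the parameter it is a continuous
  -- self-map of an interval, and a fixed point of it is a critical point.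
  have hinv := hAσ.symm.unique hA
  obtain ⟨b, γ, hb, hγ, hγi, h0, h1, hγA⟩ := hA
  have hm : MapsTo (fun s => σ (γ s)) (Icc 0 b) (γ '' Icc 0 b) := fun s hs => by
    rw [hγA, ← hinv, ← hγA]
    exact ⟨_, ⟨s, hs, rfl⟩, rfl⟩
  obtain ⟨τ, hτc, hτm, hτ⟩ := exists_lift_to_parameter hγ hγi (hσc.comp_continuousOn hγ) hm
  change ∀ s ∈ Icc 0 b, γ (τ s) = σ (γ s) at hτ
  obtain ⟨s, hs, hfix⟩ := exists_mem_Icc_isFixedPt_of_mapsTo hτc hb hτm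
  refine ⟨γ s, hγA ▸ ⟨s, hs, rfl⟩, (hcrit _).1 ?_⟩
  have := hτ s hs
  rwa [hfix, eq_comm] at this

/-- Fixing both ends, the involution would act on the arc from `c` to `d` as an increasing
involution of an interval, hence as the identity. Then all points of the arc would be critical,
against finiteness. -/
theorem IsTwoToOneBranchedCovering.critical_unique (hf : IsTwoToOneBranchedCovering f) {c d : X}
    (hc : IsCriticalPoint f c) (hd : IsCriticalPoint f d) : c = d := by
  by_contra hne
  obtain ⟨σ, hσc, hσσ, -, hcrit⟩ := hf.exists_involution
  have hinj : Function.Injective σ := (show Function.Involutive σ from hσσ).injective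
  have hA := isArc_dendriteArc c d
  have hAσ := hA.image hσc.continuousOn hinj.injOn
  rw [(hcrit c).2 hc, (hcrit d).2 hd] at hAσ
  have hinv := hAσ.unique hA
  obtain ⟨b, γ, hb, hγ, hγi, h0, h1, hγA⟩ := hA
  have hb0 : 0 < b := hb.lt_of_ne fun h => hne (by rw [← h0, ← h1, ← h])
  have hm : MapsTo (fun s => σ (γ s)) (Icc 0 b) (γ '' Icc 0 b) := fun s hs => by
    rw [hγA, ← hinv, ← hγA]
    exact ⟨_, ⟨s, hs, rfl⟩, rfl⟩
  obtain ⟨τ, hτc, hτm, hτ⟩ := exists_lift_to_parameter hγ hγi (hσc.comp_continuousOn hγ) hm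
  change ∀ s ∈ Icc 0 b, γ (τ s) = σ (γ s) at hτ
  have hττ : ∀ s ∈ Icc 0 b, τ (τ s) = s := fun s hs => by
    refine hγi (hτm (hτm hs)) hs ?_
    rw [hτ _ (hτm hs), hτ s hs, hσσ]
  have hτ0 : τ 0 = 0 := hγi (hτm ⟨le_rfl, hb⟩) ⟨le_rfl, hb⟩ (by
    rw [hτ 0 ⟨le_rfl, hb⟩, h0, (hcrit c).2 hc])
  have hτi : InjOn τ (Icc 0 b) := fun s hs t ht h => by rw [← hττ s hs, h, hττ t ht]
  have hmono : StrictMonoOn τ (Icc 0 b) :=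
    hτc.strictMonoOn_of_injOn_Icc hb (by rw [hτ0]; exact (hτm ⟨hb, le_rfl⟩).1) hτi
  refine Set.infinite_of_injOn_mapsTo hγi (fun s hs => ?_) (Icc_infinite hb0) hf.finite_critical
  refine (hcrit _).1 ?_
  have hs' : τ s = s := by
    rcases lt_trichotomy (τ s) s with h | h | h
    · have := hmono (hτm hs) hs h
      rw [hττ s hs] at this
      exact absurd this h.not_gt
    · exact h
    · have := hmono hs (hτm hs) h
      rw [hττ s hs] at this
      exact absurd this h.not_gt
  rw [← hτ s hs, hs']

/-- A `2`-to-`1` branched covering is injective on connected sets which avoid the critical point,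
and remains so if the critical point is added to the set. -/
theorem IsTwoToOneBranchedCovering.injOn_insert (hf : IsTwoToOneBranchedCovering f) {c : X}
    (hc : IsCriticalPoint f c) {S : Set X} (hS : IsPreconnected S) (hcS : c ∉ S) :
    InjOn f (insert c S) := by
  have hfib : ∀ x, f x = f c → x = c := fun x hx => Set.ext_iff.1 (hf.fibre_critical c hc) x |>.1 hx
  rintro x (rfl | hx) y (rfl | hy) hxy
  · rfl
  · exact (hfib y hxy.symm).symm
  · exact hfib x hxy
  · by_contra hne
    obtain ⟨d, hd, hdc⟩ := hf.exists_critical_mem_dendriteArc hxy hne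
    rw [hf.critical_unique hdc hc] at hd
    exact hcS (dendriteArc_subset hS hx hy hd)

end BranchedCoverings

/-! ### Dichotomy for returning arcs: identity return or wandering continuum. -/

section ReturningArcs

variable {X : Type u} [TopologicalSpace X] {f : X → X} {Y : Set X}

/-- A common point of `f^[m] '' J` and `f^[n] '' J` with `m < n` can be pulled back through `f^[m]`
by injectivity, so it is enough that `J` never meets its own later images. -/
theorem hasWanderingContinuum_of_injOn (hY : MapsTo f Y Y) (hi : InjOn f Y) {J : Set X}
    (hJ : IsContinuum J) (hJn : J.Nontrivial) (hJY : J ⊆ Y)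
    (h : ∀ j, 0 < j → ∀ x ∈ J, f^[j] x ∉ J) : HasWanderingContinuum f := by
  refine ⟨J, hJ, hJn, ?_⟩
  have key : ∀ m n, m < n → Disjoint (f^[m] '' J) (f^[n] '' J) := by
    intro m n hmn
    refine disjoint_left.2 ?_
    rintro _ ⟨x, hx, rfl⟩ ⟨y, hy, hxy⟩
    have e : n = m + (n - m) := by omega
    rw [e, Function.iterate_add_apply] at hxy
    have := hi.iterate hY m (hY.iterate _ (hJY hy)) (hJY hx) hxy
    exact h (n - m) (by omega) y hy (this ▸ hx)
  intro m n hmn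
  rcases lt_or_gt_of_ne hmn with h | h
  exacts [key m n h, (key n m h).symm]

/-- If an injective map returns an initial segment of an arc to the same arc, while the images at
the intermediate times avoid the arc, then there is an identity return or a wandering continuum. -/
theorem hasIdentityReturn_or_hasWanderingContinuum [T2Space X] (hf : Continuous f)
    (hY : MapsTo f Y Y) (hi : InjOn f Y) {N : ℕ} (hN : 0 < N) {γ : ℝ → X} {b t : ℝ}
    (hγ : ContinuousOn γ (Icc 0 b)) (hγi : InjOn γ (Icc 0 b)) (hγY : MapsTo γ (Icc 0 b) Y)
    (h0 : f^[N] (γ 0) = γ 0) (ht0 : 0 < t) (htb : t ≤ b)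
    (hret : MapsTo (fun s => f^[N] (γ s)) (Icc 0 t) (γ '' Icc 0 b))
    (hr : ∀ r, 0 < r → r < N → ∀ u ∈ Ioc 0 b, ∀ v ∈ Ioc 0 b, f^[r] (γ u) ≠ γ v) :
    HasIdentityReturn f ∨ HasWanderingContinuum f := by
  have hb0 : (0 : ℝ) ∈ Icc 0 b := ⟨le_rfl, ht0.le.trans htb⟩
  have hsub : Icc 0 t ⊆ Icc 0 b := Icc_subset_Icc le_rfl htb
  obtain ⟨φ, hφc, hφm, hφ⟩ := exists_lift_to_parameter hγ hγi
    ((hf.iterate N).comp_continuousOn (hγ.mono hsub)) hret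
  change ∀ s ∈ Icc 0 t, γ (φ s) = f^[N] (γ s) at hφ
  have hφ0 : φ 0 = 0 := hγi (hφm ⟨le_rfl, ht0.le⟩) hb0 (by rw [hφ 0 ⟨le_rfl, ht0.le⟩, h0])
  have hφi : InjOn φ (Icc 0 t) := fun u hu v hv huv => by
    refine hγi (hsub hu) (hsub hv) (hi.iterate hY N (hγY (hsub hu)) (hγY (hsub hv)) ?_)
    rw [← hφ u hu, ← hφ v hv, huv]
  have hmono : StrictMonoOn φ (Icc 0 t) :=
    hφc.strictMonoOn_of_injOn_Icc ht0.le (by rw [hφ0]; exact (hφm ⟨ht0.le, le_rfl⟩).1) hφi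
  have hpos : ∀ u ∈ Ioc 0 t, 0 < φ u := fun u hu => by
    have := hmono ⟨le_rfl, ht0.le⟩ (Ioc_subset_Icc_self hu) hu.1
    rwa [hφ0] at this
  have hcont : ∀ p q, 0 ≤ p → q ≤ b → p < q →
      IsContinuum (γ '' Icc p q) ∧ (γ '' Icc p q).Nontrivial := fun p q hp hq hpq => by
    have hs : Icc p q ⊆ Icc 0 b := Icc_subset_Icc hp hq
    refine ⟨(isArc_image_Icc hpq.le (hγ.mono hs) (hγi.mono hs)).isContinuum,
      γ p, ⟨p, ⟨le_rfl, hpq.le⟩, rfl⟩, γ q, ⟨q, ⟨hpq.le, le_rfl⟩, rfl⟩, fun h => ?_⟩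
    exact hpq.ne (hγi (hs ⟨le_rfl, hpq.le⟩) (hs ⟨hpq.le, le_rfl⟩) h)
  by_cases hid : ∀ s ∈ Icc 0 t, φ s = s
  · refine Or.inl ⟨γ '' Icc 0 t, (hcont 0 t le_rfl htb ht0).1, (hcont 0 t le_rfl htb ht0).2,
      N, hN, ?_⟩
    rintro _ ⟨s, hs, rfl⟩
    rw [← hφ s hs, hid s hs]
  right
  push Not at hid
  obtain ⟨s, hs, hφs⟩ := hid
  have hs0 : 0 < s := hs.1.lt_of_ne (by rintro rfl; exact hφs hφ0)
  have hφs0 := hpos s ⟨hs0, hs.2⟩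
  have hφsb := (hφm hs).2
  suffices ∃ p q, 0 < p ∧ p < q ∧ q ≤ b ∧
      ∀ j, 0 < j → ∀ u ∈ Icc p q, ∀ v ∈ Icc p q, f^[j] (γ v) ≠ γ u by
    obtain ⟨p, q, hp, hpq, hq, h⟩ := this
    refine hasWanderingContinuum_of_injOn hY hi (hcont p q hp.le hq hpq).1
      (hcont p q hp.le hq hpq).2 ?_ ?_
    · rintro _ ⟨u, hu, rfl⟩
      exact hγY ⟨hp.le.trans hu.1, hu.2.trans hq⟩
    · rintro j hj _ ⟨v, hv, rfl⟩ ⟨u, hu, huv⟩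
      exact h j hj u hu v hv huv.symm
  -- If `φ s < s`, every return of a parameter in `Ioc 0 s` is at most `φ s`. Starting `J` at the
  -- midpoint of `φ s` and `s` keeps it strictly clear of its returns; times not divisible by `N`
  -- are excluded by `hr`.
  rcases lt_or_gt_of_ne hφs with hlt | hgt
  · have claim : ∀ i, ∀ v ∈ Ioc 0 s, ∃ w ∈ Ioc 0 s, (f^[N])^[i] (γ v) = γ w ∧
        (0 < i → w ≤ φ s) := by
      intro i
      induction i with
      | zero => exact fun v hv => ⟨v, hv, rfl, fun h => absurd h (lt_irrefl _)⟩
      | succ i ih =>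
        intro v hv
        obtain ⟨w, hw, h1, -⟩ := ih v hv
        have hw' : w ∈ Icc 0 t := ⟨hw.1.le, hw.2.trans hs.2⟩
        have h2 : φ w ≤ φ s := hmono.monotoneOn hw' hs hw.2
        refine ⟨φ w, ⟨hpos w ⟨hw.1, hw'.2⟩, h2.trans hlt.le⟩, ?_, fun _ => h2⟩
        rw [Function.iterate_succ_apply', h1, hφ w hw']
    refine ⟨(φ s + s) / 2, s, by linarith, by linarith, hs.2.trans htb, fun j hj u hu v hv h => ?_⟩
    obtain ⟨w, hw, h1, h2⟩ := claim (j / N) v ⟨by linarith [hv.1], hv.2⟩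
    have e : f^[j] (γ v) = f^[j % N] (γ w) := by
      rw [← h1, ← Function.iterate_mul, ← Function.iterate_add_apply, Nat.mod_add_div]
    rw [e] at h
    rcases Nat.eq_zero_or_pos (j % N) with h3 | h3
    · rw [h3, Function.iterate_zero, id] at h
      have h4 := hγi ⟨hw.1.le, hw.2.trans (hs.2.trans htb)⟩
        ⟨by linarith [hu.1], hu.2.trans (hs.2.trans htb)⟩ h
      have h5 := h2 (Nat.div_pos (Nat.le_of_dvd hj (Nat.dvd_of_mod_eq_zero h3)) hN)
      linarith [hu.1]
    · exact hr _ h3 (Nat.mod_lt _ hN) w ⟨hw.1, hw.2.trans (hs.2.trans htb)⟩ u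
        ⟨by linarith [hu.1], hu.2.trans (hs.2.trans htb)⟩ h
  -- Here points are pushed outward and may leave the domain of `φ`, so preimages are followed
  -- instead: they stay in `Ioc 0 (φ s)` and drop to at most `s` after one step.
  · have claim : ∀ i, ∀ u ∈ Ioc 0 (φ s), ∃ w ∈ Ioc 0 (φ s), (f^[N])^[i] (γ w) = γ u ∧
        (0 < i → w ≤ s) := by
      intro i
      induction i with
      | zero => exact fun v hv => ⟨v, hv, rfl, fun h => absurd h (lt_irrefl _)⟩
      | succ i ih =>
        intro u hu
        obtain ⟨w, hw, h1, -⟩ := ih u hu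
        obtain ⟨w', hw', h2⟩ := intermediate_value_Icc hs.1
          (hφc.mono (Icc_subset_Icc le_rfl hs.2)) (show w ∈ Icc (φ 0) (φ s) from
            ⟨by rw [hφ0]; exact hw.1.le, hw.2⟩)
        have hw0 : 0 < w' := hw'.1.lt_of_ne fun h => by
          rw [← h, hφ0] at h2
          exact hw.1.ne h2
        refine ⟨w', ⟨hw0, hw'.2.trans hgt.le⟩, ?_, fun _ => hw'.2⟩
        rw [Function.iterate_succ_apply, ← hφ w' ⟨hw'.1, hw'.2.trans hs.2⟩, h2, h1]
    refine ⟨(φ s + s) / 2, φ s, by linarith, by linarith, hφsb, fun j hj u hu v hv h => ?_⟩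
    obtain ⟨w, hw, h1, h2⟩ := claim (j / N) u ⟨by linarith [hu.1], hu.2⟩
    have hvb : v ∈ Icc 0 b := ⟨by linarith [hv.1], hv.2.trans hφsb⟩
    have hwb : w ∈ Icc 0 b := ⟨hw.1.le, hw.2.trans hφsb⟩
    have e : f^[j % N] (γ v) = γ w := by
      refine hi.iterate hY (N * (j / N)) (hY.iterate _ (hγY hvb)) (hγY hwb) ?_
      rw [← Function.iterate_add_apply, Nat.div_add_mod, h, Function.iterate_mul, h1]
    rcases Nat.eq_zero_or_pos (j % N) with h3 | h3
    · rw [h3, Function.iterate_zero, id] at e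
      have h4 := hγi hvb hwb e
      have h5 := h2 (Nat.div_pos (Nat.le_of_dvd hj (Nat.dvd_of_mod_eq_zero h3)) hN)
      linarith [hv.1]
    · exact hr _ h3 (Nat.mod_lt _ hN) v ⟨by linarith [hv.1], hvb.2⟩ w ⟨hw.1, hwb.2⟩ e

end ReturningArcs

/-! ### The case of a fixed critical point. -/

section FixedCriticalPoint

theorem iterate_ne_of_fibre {X : Type u} {f : X → X} {c : X} (hfib : ∀ x, f x = c → x = c) {x : X}
    (hx : x ≠ c) (i : ℕ) : f^[i] x ≠ c := by
  induction i with
  | zero => exact hx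
  | succ i ih =>
    rw [Function.iterate_succ_apply']
    exact fun h => ih (hfib _ h)

variable {X : Type u} [TopologicalSpace X] {f : X → X} {c : X}

/-- A map for which the point `c` is totally invariant takes components of the complement of `c`
into such components. -/
theorem mapsTo_connectedComponentIn_compl (hf : Continuous f)
    (hfib : ∀ x, f x = c → x = c) (x : X)
    (hx : x ≠ c) : MapsTo f (connectedComponentIn {c}ᶜ x) (connectedComponentIn {c}ᶜ (f x)) := by
  have h1 : IsPreconnected (f '' connectedComponentIn {c}ᶜ x) :=
    isPreconnected_connectedComponentIn.image f hf.continuousOn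
  have h2 := h1.subset_connectedComponentIn (mem_image_of_mem f (mem_connectedComponentIn hx))
    (F := {c}ᶜ) (by
      rintro _ ⟨y, hy, rfl⟩ h
      exact connectedComponentIn_subset _ _ hy (hfib y h))
  exact image_subset_iff.1 h2

variable [Dendrite X]

/-- A component of the complement of a fixed critical point cannot be periodic, unless there is an
identity return or a wandering continuum. -/
theorem IsTwoToOneBranchedCovering.return_of_periodic_component
    (hf : IsTwoToOneBranchedCovering f) (hc : IsCriticalPoint f c) (hfix : f c = c) {x : X}
    (hx : x ≠ c) (hper : ∃ n, 0 < n ∧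
      connectedComponentIn {c}ᶜ (f^[n] x) = connectedComponentIn {c}ᶜ x) :
    HasIdentityReturn f ∨ HasWanderingContinuum f := by
  classical
  have hfib : ∀ y, f y = c → y = c := fun y hy =>
    (Set.ext_iff.1 (hf.fibre_critical c hc) y).1 (hy.trans hfix.symm)
  let D : ℕ → Set X := fun i => connectedComponentIn {c}ᶜ (f^[i] x)
  have hne := iterate_ne_of_fibre hfib hx
  have hmem : ∀ i, f^[i] x ∈ D i := fun i => mem_connectedComponentIn (hne i)
  have hcD : ∀ i, c ∉ D i := fun i h => connectedComponentIn_subset _ _ h rfl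
  have hDc : ∀ i, IsPreconnected (D i) := fun i => isPreconnected_connectedComponentIn
  have hmaps : ∀ i, MapsTo f (D i) (D (i + 1)) := fun i => by
    have := mapsTo_connectedComponentIn_compl hf.continuous hfib (f^[i] x) (hne i)
    rwa [← Function.iterate_succ_apply' f i x] at this
  have hmaps' : ∀ k i, MapsTo f^[k] (D i) (D (i + k)) := by
    intro k
    induction k with
    | zero => exact fun i => mapsTo_id _
    | succ k ih =>
        intro i
        rw [Function.iterate_succ', ← add_assoc]
        exact (hmaps _).comp (ih i)
  have hDeq : ∀ i j, ∀ y ∈ D i, y ∈ D j → D i = D j := fun i j y hi hj =>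
    (connectedComponentIn_eq hi).trans (connectedComponentIn_eq hj).symm
  have hadd : ∀ i j k, D i = D j → D (i + k) = D (j + k) := fun i j k h => by
    refine hDeq _ _ (f^[k] (f^[i] x)) (hmaps' k i (hmem i)) (hmaps' k j ?_)
    rw [← h]
    exact hmem i
  set N := Nat.find hper with hNdef
  obtain ⟨hN, hND⟩ := Nat.find_spec hper
  rw [← hNdef] at hN hND
  change D N = D 0 at hND
  have hmin : ∀ r, 0 < r → r < N → D r ≠ D 0 := fun r h0 hr h => Nat.find_min hper hr ⟨h0, h⟩
  have hperiod : ∀ i, D (i + N) = D i := fun i => by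
    have := hadd N 0 i hND
    rwa [zero_add, add_comm] at this
  -- Periodicity makes the action on these components injective; with injectivity on each one, `f`
  -- is injective on `Y`.
  have hcan : ∀ i j, D (i + 1) = D (j + 1) → D i = D j := fun i j h => by
    have h1 := hadd _ _ (N - 1) h
    rwa [show i + 1 + (N - 1) = i + N by omega, show j + 1 + (N - 1) = j + N by omega,
      hperiod, hperiod] at h1
  let Y : Set X := insert c (⋃ i, D i)
  have hY : MapsTo f Y Y := by
    rintro y (rfl | hy)
    · exact Or.inl hfix
    · obtain ⟨i, hi⟩ := mem_iUnion.1 hy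
      exact Or.inr (mem_iUnion.2 ⟨i + 1, hmaps i hi⟩)
  have hYi : InjOn f Y := by
    rintro y (rfl | hy) z (rfl | hz) hyz
    · rfl
    · exact (hfib z (hyz.symm.trans hfix)).symm
    · exact hfib y (hyz.trans hfix)
    · obtain ⟨i, hi⟩ := mem_iUnion.1 hy
      obtain ⟨j, hj⟩ := mem_iUnion.1 hz
      have h1 := hcan i j (hDeq _ _ (f y) (hmaps i hi) (hyz ▸ hmaps j hj))
      exact hf.injOn_insert hc (hDc i) (hcD i) (Or.inr hi) (Or.inr (h1 ▸ hj)) hyz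
  have hA := isArc_dendriteArc c x
  have hApre := hA.isPreconnected
  obtain ⟨b, γ, hb, hγ, hγi, h0, h1, hγA⟩ := isArc_dendriteArc c x
  have hb0 : 0 < b := hb.lt_of_ne fun h => hx (by rw [← h0, ← h1, ← h])
  have hγD : ∀ s ∈ Ioc 0 b, γ s ∈ D 0 := by
    intro s hs
    have hsub : Icc s b ⊆ Icc 0 b := Icc_subset_Icc hs.1.le le_rfl
    have hpre : IsPreconnected (γ '' Icc s b) := isPreconnected_Icc.image _ (hγ.mono hsub)
    refine hpre.subset_connectedComponentIn (x := x) ⟨b, ⟨hs.2, le_rfl⟩, h1⟩ ?_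
      ⟨s, ⟨le_rfl, hs.2⟩, rfl⟩
    rintro _ ⟨u, hu, rfl⟩ huc
    have := hγi (hsub hu) ⟨le_rfl, hb⟩ ((show γ u = c from huc).trans h0.symm)
    linarith [hu.1, hs.1]
  have hγY : MapsTo γ (Icc 0 b) Y := by
    intro s hs
    rcases hs.1.eq_or_lt with rfl | h
    · exact Or.inl h0
    · exact Or.inr (mem_iUnion.2 ⟨0, hγD s ⟨h, hs.2⟩⟩)
  have hAY : dendriteArc c x ⊆ Y := by
    rw [← hγA]
    exact image_subset_iff.2 hγY
  have hFc : f^[N] c = c := Function.iterate_fixed hfix N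
  have hFA : ∀ y ∈ dendriteArc c x, f^[N] '' dendriteArc c y = dendriteArc c (f^[N] y) := by
    intro y hy
    have hsub := (dendriteArc_subset hApre hA.left_mem hy).trans hAY
    have := dendriteArc_image (hf.continuous.iterate N).continuousOn ((hYi.iterate hY N).mono hsub)
    rwa [hFc] at this
  -- Were the two arcs to meet only at `c`, their union would be an arc through `c` joining two
  -- points of `D 0`, a connected set without `c`.
  obtain ⟨z, hzx, hzF, hzc⟩ : ∃ z ∈ dendriteArc c x, z ∈ dendriteArc c (f^[N] x) ∧ z ≠ c := by
    by_contra! hcon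
    have h2 := hA.symm.concat (isArc_dendriteArc c (f^[N] x)) fun z hz => hcon z hz.1 hz.2
    have h3 := h2.subset_of_isPreconnected (hDc 0) (hmem 0) (hND ▸ hmem N)
    exact hcD 0 (h3 (Or.inl hA.left_mem))
  rw [← hFA x hA.right_mem, ← hγA] at hzF
  obtain ⟨_, ⟨t, ht, rfl⟩, rfl⟩ := hzF
  have ht0 : 0 < t := ht.1.lt_of_ne fun h => hzc (by rw [← h, h0, hFc])
  refine hasIdentityReturn_or_hasWanderingContinuum hf.continuous hY hYi hN hγ hγi hγY
    (by rw [h0, hFc]) ht0 ht.2 ?_ ?_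
  · intro s hs
    have hsub : Icc 0 t ⊆ Icc 0 b := Icc_subset_Icc le_rfl ht.2
    have h2 := (isArc_image_Icc ht0.le (hγ.mono hsub) (hγi.mono hsub)).dendriteArc_eq
    rw [h0] at h2
    rw [hγA]
    refine dendriteArc_subset hApre hA.left_mem hzx ?_
    rw [← hFA (γ t) (hγA ▸ ⟨t, ht, rfl⟩), h2]
    exact ⟨γ s, ⟨s, hs, rfl⟩, rfl⟩
  · intro r hr0 hrN u hu v hv huv
    have h2 := hmaps' r 0 (hγD u hu)
    rw [zero_add, huv] at h2
    exact hmin r hr0 hrN (hDeq _ _ _ h2 (hγD v hv))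

/-- If the critical point is fixed, then there is an identity return or a wandering continuum. -/
theorem IsTwoToOneBranchedCovering.return_of_fixed_critical
    (hf : IsTwoToOneBranchedCovering f) (hc : IsCriticalPoint f c) (hfix : f c = c) :
    HasIdentityReturn f ∨ HasWanderingContinuum f := by
  obtain ⟨x, hx⟩ : ∃ x, x ≠ c := by
    by_contra! h
    exact hc univ univ_mem fun y _ z _ _ => (h y).trans (h z).symm
  have hfib : ∀ y, f y = c → y = c := fun y hy =>
    (Set.ext_iff.1 (hf.fibre_critical c hc) y).1 (hy.trans hfix.symm)
  have hne := iterate_ne_of_fibre hfib hx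
  let D : ℕ → Set X := fun i => connectedComponentIn {c}ᶜ (f^[i] x)
  by_cases hD : ∃ m n, m < n ∧ D n = D m
  · obtain ⟨m, n, hmn, h⟩ := hD
    refine hf.return_of_periodic_component hc hfix (hne m) ⟨n - m, by omega, ?_⟩
    rw [← Function.iterate_add_apply, Nat.sub_add_cancel hmn.le]
    exact h
  right
  obtain ⟨b, γ, hb, hγ, hγi, h0, h1, -⟩ := isArc_dendriteArc c x
  have hb0 : 0 < b := hb.lt_of_ne fun h => hx (by rw [← h0, ← h1, ← h])
  -- The outer half of the arc avoids `c`, so its iterates lie in the pairwise different components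
  -- `D i`.
  have hsub : Icc (b / 2) b ⊆ Icc 0 b := Icc_subset_Icc (by linarith) le_rfl
  have hJ := isArc_image_Icc (by linarith) (hγ.mono hsub) (hγi.mono hsub)
  have hJc : γ '' Icc (b / 2) b ⊆ {c}ᶜ := by
    rintro _ ⟨u, hu, rfl⟩ huc
    have := hγi (hsub hu) ⟨le_rfl, hb⟩ ((show γ u = c from huc).trans h0.symm)
    linarith [hu.1]
  have hJD : ∀ i, f^[i] '' (γ '' Icc (b / 2) b) ⊆ D i := by
    intro i
    have hpre := hJ.isPreconnected.image _ (hf.continuous.iterate i).continuousOn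
    refine hpre.subset_connectedComponentIn
      ⟨x, ⟨b, ⟨by linarith, le_rfl⟩, h1⟩, rfl⟩ ?_
    induction i with
    | zero => simpa using hJc
    | succ i ih =>
      rw [Function.iterate_succ', image_comp]
      rintro _ ⟨y, hy, rfl⟩ h
      exact ih (hJ.isPreconnected.image _ (hf.continuous.iterate i).continuousOn) hy (hfib y h)
  refine ⟨_, hJ.isContinuum, ⟨_, hJ.left_mem, _, hJ.right_mem, fun h => ?_⟩, fun m n hmn => ?_⟩
  · have := hγi ⟨by linarith, by linarith⟩ ⟨hb, le_rfl⟩ h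
    linarith
  · refine (disjoint_left.2 fun z hz hz' => ?_).mono (hJD m) (hJD n)
    have h2 : D m = D n := (connectedComponentIn_eq hz).trans (connectedComponentIn_eq hz').symm
    rcases lt_or_gt_of_ne hmn with h | h
    exacts [hD ⟨m, n, h, h2.symm⟩, hD ⟨n, m, h, h2⟩]

end FixedCriticalPoint

/-! ### Endpoint block structures and their incompatibility with a periodic critical point. -/

section EndpointBlocks

variable {X : Type u} [TopologicalSpace X]

/-- A partition of `P` into cyclically permuted blocks with pairwise disjoint continuum hulls, each
of which consists of endpoints of its continuum hull. -/
structure IsEndpointBlockStructure (f : X → X) (P : Set X) (n : ℕ) (Q : Set X) : Prop where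
  pos : 0 < n
  union_eq : ⋃ i < n, f^[i] '' Q = P
  return_eq : f^[n] '' Q = Q
  disjoint_hulls : ∀ i < n, ∀ j < n, i ≠ j →
    Disjoint (continuumHull (f^[i] '' Q)) (continuumHull (f^[j] '' Q))
  isEndpointOf : ∀ i < n, ∀ p ∈ f^[i] '' Q, IsEndpointOf (continuumHull (f^[i] '' Q)) p
  nontrivial : P.Subsingleton ∨ ∀ i < n, (f^[i] '' Q).Nontrivial

namespace IsEndpointBlockStructure

variable {f : X → X} {P Q : Set X} {n : ℕ}

theorem image_add (h : IsEndpointBlockStructure f P n Q) (i : ℕ) :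
    f^[i + n] '' Q = f^[i] '' Q := by
  rw [Function.iterate_add, image_comp, h.return_eq]

theorem image_mod (h : IsEndpointBlockStructure f P n Q) (i : ℕ) :
    f^[i % n] '' Q = f^[i] '' Q := by
  have key : ∀ k r, f^[r + n * k] '' Q = f^[r] '' Q := by
    intro k
    induction k with
    | zero => simp
    | succ k ih =>
      intro r
      rw [Nat.mul_succ, ← add_assoc, h.image_add, ih]
  rw [← key (i / n) (i % n), Nat.mod_add_div]

theorem image_subset (h : IsEndpointBlockStructure f P n Q) (i : ℕ) : f^[i] '' Q ⊆ P := by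
  rw [← h.image_mod, ← h.union_eq]
  exact subset_biUnion_of_mem (u := fun i => f^[i] '' Q) (Nat.mod_lt i h.pos)

theorem hull_eq_or_disjoint (h : IsEndpointBlockStructure f P n Q) (i j : ℕ) :
    i % n = j % n ∨ Disjoint (continuumHull (f^[i] '' Q)) (continuumHull (f^[j] '' Q)) := by
  refine or_iff_not_imp_left.2 fun hij => ?_
  rw [← h.image_mod i, ← h.image_mod j]
  exact h.disjoint_hulls _ (Nat.mod_lt i h.pos) _ (Nat.mod_lt j h.pos) hij

end IsEndpointBlockStructure

/-- Induction on the generation: the block with index `j < n * m` is number `j / n` inside the older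
block number `j % n`. Blocks in one older block are separated by the new structure, the others by
the old one. -/
theorem IsRotationalOfGeneration.isBlockStructure {f : X → X} {P Q : Set X} {k n : ℕ}
    (h : IsRotationalOfGeneration f P k n Q) : IsBlockStructure f P n Q := by
  induction h with
  | first h => exact h.blocks
  | @next k n m Q R _ hR ih =>
    have hcomp : ∀ i l, (f^[n])^[l] '' (f^[i] '' R) = f^[i + n * l] '' R := fun i l => by
      rw [← Function.iterate_mul, ← image_comp, ← Function.iterate_add, add_comm]
    have hdecomp : ∀ j < n * m, j % n < n ∧ j / n < m ∧
        f^[j] '' R = (f^[n])^[j / n] '' (f^[j % n] '' R) := fun j hj => by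
      have hn : 0 < n := Nat.pos_of_ne_zero (by rintro rfl; simp at hj)
      exact ⟨Nat.mod_lt j hn, Nat.div_lt_of_lt_mul hj, by rw [hcomp, Nat.mod_add_div]⟩
    have hsub : ∀ j < n * m, f^[j] '' R ⊆ f^[j % n] '' Q := fun j hj => by
      obtain ⟨h1, h2, h3⟩ := hdecomp j hj
      rw [h3, ← (hR _ h1).blocks.union_eq]
      exact subset_biUnion_of_mem (u := fun l => (f^[n])^[l] '' (f^[j % n] '' R)) h2
    refine ⟨?_, ?_, ?_, ?_⟩
    · refine Subset.antisymm (iUnion₂_subset fun j hj => ?_) ?_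
      · obtain ⟨h1, -, -⟩ := hdecomp j hj
        refine (hsub j hj).trans ?_
        rw [← ih.union_eq]
        exact subset_biUnion_of_mem (u := fun i => f^[i] '' Q) h1
      · rw [← ih.union_eq]
        refine iUnion₂_subset fun i hi => ?_
        rw [← (hR i hi).blocks.union_eq]
        refine iUnion₂_subset fun l hl => ?_
        rw [hcomp]
        refine subset_biUnion_of_mem (u := fun j => f^[j] '' R) (show i + n * l < n * m from ?_)
        calc i + n * l < n + n * l := by omega
          _ = n * (l + 1) := by ring
          _ ≤ n * m := Nat.mul_le_mul_left n hl
    · rcases Nat.eq_zero_or_pos n with rfl | hn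
      · simp
      · simpa [Function.iterate_mul] using (hR 0 hn).blocks.return_eq
    · intro j hj
      obtain ⟨h1, h2, h3⟩ := hdecomp j hj
      rw [h3]
      exact (hR _ h1).blocks.nontrivial _ h2
    · intro j hj j' hj' hne
      obtain ⟨h1, h2, h3⟩ := hdecomp j hj
      obtain ⟨h1', h2', h3'⟩ := hdecomp j' hj'
      by_cases hmod : j % n = j' % n
      · rw [h3, h3', hmod]
        refine (hR _ h1').blocks.disjoint_hulls _ h2 _ h2' fun hdiv => hne ?_
        rw [← Nat.mod_add_div j n, ← Nat.mod_add_div j' n, hmod, hdiv]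
      · exact (ih.disjoint_hulls _ h1 _ h1' hmod).mono (continuumHull_mono (hsub j hj))
          (continuumHull_mono (hsub j' hj'))

/-- Generation one gives a single block, the whole orbit, which may be one point; this is why
`nontrivial` is a disjunction. The branching points `a` are not needed. -/
theorem IsSnowflake.exists_endpointBlockStructure {f : X → X} {P : Set X} {k : ℕ}
    (h : IsSnowflake f P k) (hP : P.Nonempty) (hfP : f '' P = P) :
    ∃ n Q, IsEndpointBlockStructure f P n Q := by
  cases h with
  | basic h =>
    have hone : ∀ i < 1, f^[i] '' P = P := fun i hi => by
      obtain rfl : i = 0 := by omega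
      simp
    refine ⟨1, P, one_pos, ?_, by simpa using hfP, fun i hi j hj hij => by omega, ?_, ?_⟩
    · simp
    · intro i hi
      rw [hone i hi]
      exact h.2.1
    · rcases P.subsingleton_or_nontrivial with h1 | h1
      · exact Or.inl h1
      · exact Or.inr fun i hi => by rwa [hone i hi]
  | @succ k n Q h hQ =>
    have hb := h.isBlockStructure
    refine ⟨n, Q, Nat.pos_of_ne_zero ?_, hb.union_eq, hb.return_eq, hb.disjoint_hulls,
      fun i hi => (hQ i hi).2.1, Or.inr hb.nontrivial⟩
    rintro rfl
    have := hb.union_eq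
    simp only [not_lt_zero, iUnion_of_empty, iUnion_empty] at this
    exact hP.ne_empty this.symm

variable [Dendrite X]

theorem isPreconnected_continuumHull {P : Set X} (hP : P.Finite) (hne : P.Nonempty) :
    IsPreconnected (continuumHull P) := by
  obtain ⟨p, hp⟩ := hne
  rw [continuumHull_eq_iUnion hP hp, biUnion_eq_iUnion]
  exact isPreconnected_iUnion ⟨p, mem_iInter.2 fun q => (isArc_dendriteArc p q).left_mem⟩
    fun q => (isArc_dendriteArc p q).isPreconnected

/-- Endpoint block structures are preserved by equivalence of triples. -/
theorem IsEndpointBlockStructure.image {Y : Type*} [TopologicalSpace Y] [Dendrite Y] {f : X → X}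
    {f' : Y → Y} {P Q : Set X} {n : ℕ} (h : IsEndpointBlockStructure f P n Q) (hP : P.Finite)
    (hPn : P.Nonempty) {g : X → Y} (hc : ContinuousOn g (continuumHull P))
    (hi : InjOn g (continuumHull P)) (hg : ∀ x ∈ P, g (f x) = f' (g x)) :
    IsEndpointBlockStructure f' (g '' P) n (g '' Q) := by
  have hfP : ∀ i, ∀ x ∈ Q, f^[i] x ∈ P := fun i x hx => h.image_subset i ⟨x, hx, rfl⟩
  have hit : ∀ i, ∀ x ∈ Q, g (f^[i] x) = f'^[i] (g x) := by
    intro i x hx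
    induction i with
    | zero => rfl
    | succ i ih => rw [Function.iterate_succ_apply', Function.iterate_succ_apply', ← ih,
        hg _ (hfP i x hx)]
  have himg : ∀ i, f'^[i] '' (g '' Q) = g '' (f^[i] '' Q) := fun i => by
    rw [image_image, image_image]
    exact image_congr fun x hx => (hit i x hx).symm
  have hQn : Q.Nonempty := by
    by_contra hQ
    rw [not_nonempty_iff_eq_empty] at hQ
    have := h.union_eq
    simp only [hQ, image_empty, iUnion_empty] at this
    exact hPn.ne_empty this.symm
  have hsub : ∀ i, continuumHull (f^[i] '' Q) ⊆ continuumHull P := fun i =>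
    continuumHull_mono (h.image_subset i)
  have hhull : ∀ i, continuumHull (f'^[i] '' (g '' Q)) = g '' continuumHull (f^[i] '' Q) := by
    intro i
    rw [himg, image_continuumHull (hP.subset (h.image_subset i)) (hQn.image _)
      (hc.mono (hsub i)) (hi.mono (hsub i))]
  refine ⟨h.pos, ?_, ?_, ?_, ?_, ?_⟩
  · simp only [himg, ← h.union_eq, image_iUnion₂]
  · rw [himg, h.return_eq]
  · intro i hin j hjn hij
    rw [hhull, hhull]
    exact (h.disjoint_hulls i hin j hjn hij).image hi (hsub i) (hsub j)
  · intro i hin p hp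
    rw [himg] at hp
    obtain ⟨q, hq, rfl⟩ := hp
    have hq' := h.isEndpointOf i hin q hq
    rw [hhull]
    refine ⟨mem_image_of_mem g hq'.1, ?_⟩
    -- By injectivity the punctured hull of the image is the image of the punctured hull, hence
    -- connected.
    rw [← image_singleton, ← (hi.mono (hsub i)).image_sdiff_subset (singleton_subset_iff.2 hq'.1)]
    exact hq'.2.image g (hc.mono (sdiff_subset.trans (hsub i)))
  · refine h.nontrivial.imp (fun h1 => h1.image g) fun h1 i hin => ?_
    rw [himg]
    exact (h1 i hin).image_of_injOn (hi.mono ((h.image_subset i).trans (subset_continuumHull P)))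

/-- The orbit of a periodic critical point has no endpoint block structure, unless there is an
identity return or a wandering continuum. -/
theorem IsEndpointBlockStructure.hasIdentityReturn_or_hasWanderingContinuum {f : X → X}
    (hf : IsTwoToOneBranchedCovering f) {c : X} (hc : IsCriticalPoint f c)
    (hper : c ∈ Function.periodicPts f) (hfin : (forwardOrbit f c).Finite) {n : ℕ} {Q : Set X}
    (h : IsEndpointBlockStructure f (forwardOrbit f c) n Q) :
    HasIdentityReturn f ∨ HasWanderingContinuum f := by
  rcases h.nontrivial with hsub | hnt
  · exact hf.return_of_fixed_critical hc (hsub ⟨1, rfl⟩ ⟨0, rfl⟩)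
  set N := Function.minimalPeriod f c with hNdef
  have hN : 0 < N := Function.minimalPeriod_pos_of_mem_periodicPts hper
  have hNc : f^[N] c = c := Function.iterate_minimalPeriod
  have hNq : ∀ q ∈ forwardOrbit f c, f^[N] q = q := by
    rintro _ ⟨i, rfl⟩
    change f^[N] (f^[i] c) = f^[i] c
    rw [← Function.iterate_add_apply, add_comm, Function.iterate_add_apply, hNc]
  let H : ℕ → Set X := fun i => continuumHull (f^[i] '' Q)
  have hBn : ∀ i, (f^[i] '' Q).Nontrivial := fun i => by
    rw [← h.image_mod]
    exact hnt _ (Nat.mod_lt i h.pos)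
  have hBf : ∀ i, (f^[i] '' Q).Finite := fun i => hfin.subset (h.image_subset i)
  have hHmod : ∀ i j, i % n = j % n → H i = H j := fun i j hij => by
    simp only [H]
    rw [← h.image_mod i, hij, h.image_mod]
  obtain ⟨i₀, hi₀, hci₀⟩ : ∃ i, i < n ∧ c ∈ f^[i] '' Q := by
    have : c ∈ forwardOrbit f c := ⟨0, rfl⟩
    rw [← h.union_eq] at this
    obtain ⟨i, hi, hci⟩ := mem_iUnion₂.1 this
    exact ⟨i, hi, hci⟩
  -- The endpoint condition enters here: removing `c` from the hull of its own block leaves a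
  -- connected set, and disjointness keeps `c` out of all other hulls.
  have hHi : ∀ i, InjOn f (H i) := by
    intro i
    by_cases hci : c ∈ H i
    · have e : i % n = i₀ % n := (h.hull_eq_or_disjoint i i₀).resolve_right fun hd =>
        disjoint_left.1 hd hci (subset_continuumHull _ hci₀)
      rw [hHmod i i₀ e]
      refine (hf.injOn_insert hc (h.isEndpointOf i₀ hi₀ c hci₀).2 (by simp)).mono ?_
      exact subset_insert_sdiff_singleton c _
    · exact (hf.injOn_insert hc (isPreconnected_continuumHull (hBf i) (hBn i).nonempty) hci).mono
        (subset_insert c _)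
  have hfH : ∀ i, f '' H i = H (i + 1) := fun i => by
    simp only [H]
    rw [image_continuumHull (hBf i) (hBn i).nonempty hf.continuous.continuousOn (hHi i),
      ← image_comp, ← Function.iterate_succ']
  let Y : Set X := ⋃ i, H i
  have hY : MapsTo f Y Y := by
    intro y hy
    obtain ⟨i, hi⟩ := mem_iUnion.1 hy
    exact mem_iUnion.2 ⟨i + 1, hfH i ▸ mem_image_of_mem f hi⟩
  have hYi : InjOn f Y := by
    intro y hy z hz hyz
    obtain ⟨i, hi⟩ := mem_iUnion.1 hy
    obtain ⟨j, hj⟩ := mem_iUnion.1 hz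
    have h1 : f y ∈ H (i + 1) := hfH i ▸ mem_image_of_mem f hi
    have h2 : f y ∈ H (j + 1) := hyz ▸ hfH j ▸ mem_image_of_mem f hj
    have h3 : (i + 1) % n = (j + 1) % n := (h.hull_eq_or_disjoint (i + 1) (j + 1)).resolve_right
      fun hd => disjoint_left.1 hd h1 h2
    have h4 : i % n = j % n := Nat.ModEq.add_right_cancel' 1 h3
    exact hHi i hi (hHmod i j h4 ▸ hj) hyz
  obtain ⟨q, hq, hqc⟩ := (hBn i₀).exists_ne c
  have hAY : dendriteArc c q ⊆ Y := (dendriteArc_subset_continuumHull hci₀ hq).trans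
    (subset_iUnion H i₀)
  have hFA : f^[N] '' dendriteArc c q = dendriteArc c q := by
    rw [dendriteArc_image (hf.continuous.iterate N).continuousOn ((hYi.iterate hY N).mono hAY), hNc,
      hNq q (h.image_subset i₀ hq)]
  obtain ⟨b, γ, hb, hγ, hγi, h0, h1, hγA⟩ := isArc_dendriteArc c q
  have hb0 : 0 < b := hb.lt_of_ne fun h => hqc (by rw [← h0, ← h1, ← h])
  obtain ⟨φ, hφc, hφm, hφ⟩ := exists_lift_to_parameter hγ hγi
    ((hf.continuous.iterate N).comp_continuousOn hγ) (fun s hs => by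
      rw [hγA, ← hFA, ← hγA]
      exact ⟨γ s, ⟨s, hs, rfl⟩, rfl⟩)
  change ∀ s ∈ Icc 0 b, γ (φ s) = f^[N] (γ s) at hφ
  have hφ0 : φ 0 = 0 := hγi (hφm ⟨le_rfl, hb⟩) ⟨le_rfl, hb⟩ (by rw [hφ 0 ⟨le_rfl, hb⟩, h0, hNc])
  -- An intermediate iterate may return to the hull of the block, but it moves `c`; near `c` it
  -- therefore sends no point of the arc back close to `c`.
  obtain ⟨W, hW, hWr⟩ : ∃ W ∈ 𝓝 c, ∀ u ∈ W, ∀ v ∈ W, ∀ r ∈ Finset.range N, 0 < r →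
      f^[r] u ≠ v := by
    have : ∀ᶠ p : X × X in 𝓝 (c, c), ∀ r ∈ Finset.range N, 0 < r → f^[r] p.1 ≠ p.2 := by
      rw [Finset.eventually_all]
      intro r hr
      by_cases hr0 : 0 < r
      · have hne : f^[r] c ≠ c :=
          Function.not_isPeriodicPt_of_pos_of_lt_minimalPeriod hr0.ne' (Finset.mem_range.1 hr)
        have hopen : IsOpen {p : X × X | f^[r] p.1 ≠ p.2} :=
          isOpen_ne_fun ((hf.continuous.iterate r).comp continuous_fst) continuous_snd
        filter_upwards [hopen.mem_nhds hne] with p hp _ using hp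
      · exact Eventually.of_forall fun p h => absurd h hr0
    rw [nhds_prod_eq] at this
    obtain ⟨W, hW, h⟩ := mem_prod_same_iff.1 this
    exact ⟨W, hW, fun u hu v hv => h (mk_mem_prod hu hv)⟩
  obtain ⟨b', hb'0, hb'b, hb'W⟩ : ∃ b', 0 < b' ∧ b' ≤ b ∧ ∀ s ∈ Icc 0 b', γ s ∈ W := by
    have := hγ 0 ⟨le_rfl, hb⟩
    rw [ContinuousWithinAt, h0] at this
    obtain ⟨ε, hε, h⟩ := Metric.mem_nhdsWithin_iff.1 (this hW)
    refine ⟨min (ε / 2) b, by positivity, min_le_right _ _, fun s hs => h ⟨?_, hs.1,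
      hs.2.trans (min_le_right _ _)⟩⟩
    rw [Metric.mem_ball, Real.dist_eq, sub_zero, abs_of_nonneg hs.1]
    linarith [hs.2.trans (min_le_left _ _)]
  -- The arc was cut down to parameter `b'` to lie in `W`; a shorter segment still returns into what
  -- is left.
  obtain ⟨t, ht0, htb, ht⟩ : ∃ t, 0 < t ∧ t ≤ b' ∧ ∀ s ∈ Icc 0 t, φ s ≤ b' := by
    have := hφc 0 ⟨le_rfl, hb⟩
    rw [ContinuousWithinAt, hφ0] at this
    obtain ⟨ε, hε, h⟩ := Metric.mem_nhdsWithin_iff.1 (this (Iic_mem_nhds hb'0))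
    refine ⟨min (ε / 2) b', by positivity, min_le_right _ _, fun s hs => h ⟨?_, hs.1,
      (hs.2.trans (min_le_right _ _)).trans hb'b⟩⟩
    rw [Metric.mem_ball, Real.dist_eq, sub_zero, abs_of_nonneg hs.1]
    linarith [hs.2.trans (min_le_left _ _)]
  have hsub : Icc 0 b' ⊆ Icc 0 b := Icc_subset_Icc le_rfl hb'b
  refine _root_.hasIdentityReturn_or_hasWanderingContinuum hf.continuous hY hYi hN (hγ.mono hsub)
    (hγi.mono hsub) (fun s hs => hAY (hγA ▸ ⟨s, hsub hs, rfl⟩)) (by rw [h0, hNc]) ht0 htb ?_ ?_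
  · intro s hs
    have hsb : s ∈ Icc 0 b := hsub ⟨hs.1, hs.2.trans htb⟩
    exact ⟨φ s, ⟨(hφm hsb).1, ht s hs⟩, hφ s hsb⟩
  · intro r hr0 hrN u hu v hv
    exact hWr _ (hb'W u (Ioc_subset_Icc_self hu)) _ (hb'W v (Ioc_subset_Icc_self hv)) r
      (Finset.mem_range.2 hrN) hr0

end EndpointBlocks

/-! ### Transport to the orbit of the critical point. -/

section Patterns

theorem forwardOrbit_finite {X : Type u} {f : X → X} {p : X} (hp : p ∈ Function.periodicPts f) :
    (forwardOrbit f p).Finite := by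
  refine (Set.toFinite ((fun i => f^[i] p) '' Iio (Function.minimalPeriod f p))).subset ?_
  rintro _ ⟨i, rfl⟩
  exact ⟨i % Function.minimalPeriod f p,
    Nat.mod_lt i (Function.minimalPeriod_pos_of_mem_periodicPts hp),
    Function.iterate_mod_minimalPeriod_eq⟩

theorem image_forwardOrbit {X : Type u} {f : X → X} {p : X} (hp : p ∈ Function.periodicPts f) :
    f '' forwardOrbit f p = forwardOrbit f p := by
  refine Subset.antisymm ?_ ?_
  · rintro _ ⟨_, ⟨i, rfl⟩, rfl⟩
    exact ⟨i + 1, Function.iterate_succ_apply' f i p⟩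
  · rintro _ ⟨i, rfl⟩
    have hN := Function.minimalPeriod_pos_of_mem_periodicPts hp
    refine ⟨_, ⟨i + (Function.minimalPeriod f p - 1), rfl⟩, ?_⟩
    change f (f^[_] p) = f^[i] p
    rw [← Function.iterate_succ_apply' f, Nat.succ_eq_add_one,
      show i + (Function.minimalPeriod f p - 1) + 1 = i + Function.minimalPeriod f p by omega,
      Function.iterate_add_apply, Function.iterate_minimalPeriod]

/-- The homeomorphism of hulls, extended by the arbitrary value `t.p`, is continuous and injective
where it matters and conjugates the maps on the orbits. -/
theorem OrbitTriple.Equivalent.exists_endpointBlockStructure {s t : OrbitTriple.{u}}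
    (h : s.Equivalent t) {n : ℕ} {Q : Set s.X} (hQ : IsEndpointBlockStructure s.f s.P n Q) :
    ∃ Q', IsEndpointBlockStructure t.f t.P n Q' := by
  classical
  obtain ⟨e, heP, hef⟩ := h
  let g : s.X → t.X := fun x => if hx : x ∈ continuumHull s.P then e ⟨x, hx⟩ else t.p
  have hg : ∀ x : continuumHull s.P, g x = e x := fun x => dif_pos x.2
  have hsP := subset_continuumHull s.P
  have hgP : g '' s.P = t.P := by
    refine Subset.antisymm ?_ fun y hy => ?_
    · rintro _ ⟨x, hx, rfl⟩
      rw [hg ⟨x, hsP hx⟩]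
      exact (heP _).1 hx
    · have hy' := subset_continuumHull t.P hy
      refine ⟨e.symm ⟨y, hy'⟩, (heP _).2 (by rwa [e.apply_symm_apply]), ?_⟩
      rw [hg, e.apply_symm_apply]
  have hc : ContinuousOn g (continuumHull s.P) := by
    rw [continuousOn_iff_continuous_domRestrict]
    exact (continuous_subtype_val.comp e.continuous).congr fun x => (hg x).symm
  have hi : InjOn g (continuumHull s.P) := by
    intro x hx y hy hxy
    rw [hg ⟨x, hx⟩, hg ⟨y, hy⟩] at hxy
    exact congrArg Subtype.val (e.injective (Subtype.ext hxy))
  refine ⟨g '' Q, hgP ▸ hQ.image (forwardOrbit_finite s.periodic) ⟨_, 0, rfl⟩ hc hi ?_⟩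
  intro x hx
  rw [hg ⟨x, hsP hx⟩, hg ⟨s.f x, hsP (s.f_mem hx)⟩]
  exact hef ⟨x, hsP hx⟩ ⟨s.f x, hsP (s.f_mem hx)⟩ hx rfl

end Patterns

theorem mainTheorem8 {X : Type u} [TopologicalSpace X] [Dendrite X] (f : X → X)
    (hf : IsClassT f) (c : X) (hc : IsCriticalPoint f c)
    (hper : c ∈ Function.periodicPts f) :
    ¬ (patternOf f c hper).IsSnowflake := by
  rintro ⟨k, s, hs, hsk⟩
  obtain ⟨n, Q, hQ⟩ := hsk.exists_endpointBlockStructure ⟨_, 0, rfl⟩ (image_forwardOrbit s.periodic)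
  obtain ⟨Q', hQ'⟩ := (Quotient.exact hs).exists_endpointBlockStructure hQ
  rcases hQ'.hasIdentityReturn_or_hasWanderingContinuum hf.branched hc hper
    (forwardOrbit_finite hper) with h | h
  exacts [hf.no_identity_return h, hf.no_wandering h]
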